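/- For an autonomous system $q'=F(q)$ in $\mathbb{R}^d$, let $J(x)=F'(x)$, $R_x(y)=F(y)-F(x)-J(x)(y-x)$ and $\varphi_k(L)=\sum_{n\ge 0} L^n/(n+k)!$. For a real $M\times P$ matrix $A=(\alpha_{m,i})$, consider the multistep exponential propagation iterative (EPI) method with constant step $h$ $$q_{n+1}=q_n+\varphi_1(hJ_n)\,hF(q_n)+\sum_{m=1}^{M}\varphi_m(hJ_n)v_m,\qquad v_m=\sum_{i=1}^{P}\alpha_{m,i}\,h\,R_{q_n}(q_{n-i}),\qquad J_n=J(q_n).$$ EPI4, EPI5 and EPI6 are the methods with, respectively, $$A_4=\begin{pmatrix}0&0\\-\frac{3}{10}&\frac{3}{40}\\ \frac{32}{5}&-\frac{11}{10}\end{pmatrix},\quad A_5=\begin{pmatrix}0&0&0\\-\frac45&\frac25&-\frac{4}{45}\\12&-\frac92&\frac89\\3&0&-\frac13\end{pmatrix},\quad A_6=\begin{pmatrix}0&0&0&0\\-\frac{49}{60}&\frac{351}{560}&-\frac{359}{1260}&\frac{367}{6720}\\ \frac{92}{7}&-\frac{99}{14}&\frac{176}{63}&-\frac12\\ \frac{485}{21}&-\frac{151}{14}&\frac{23}{9}&-\frac{31}{168}\end{pmatrix}.$$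 Consider a solution $q$ on $[t_0,t_1]$ with values in an open set $U\subseteq\mathbb{R}^d$. The local error at $t$, where $t_0\le t-Ph$ and $t+h\le t_1$, is the result of one step from the exact values $q(t),q(t-h),\dots,q(t-Ph)$ minus $q(t+h)$. A method has *local order* $p$ if, for all $d$, $U$, all $F$ of class $C^p$ on $U$ and all such solutions, there are $C$ and $h_0>0$ such that the local error has norm at most $Ch^{p+1}$ for all $0<h\le h_0$ and all such $t$. It has *global order* $p$ if, for all such $F$ and $q$ and every $C_0$, there are $C$ and $h_0>0$ such that, for all $0<h\le h_0$: if the starting values satisfy $\|q_n-q(t_0+nh)\|\le C_0h^p$ for those $n\in\{0,\dots,P\}$ with $t_0+nh\le t_1$, and all later $q_n$ are computed by the method, then $\|q_n-q(t_0+nh)\|\le Ch^p$ for all $n\ge 0$ with $t_0+nh\le t_1$. Then for $p=4,5,6$ the method with matrix $A_p$ has classical order exactly $p$: it has local order $p$ and global order $p$, but neither local order $p+1$ nor global order $p+1$. Moreover its leading error coefficients are of the smallest possible magnitude: there are real numbers $e_0,\dots,e_{p-2}$ such that, for all $F$ of class $C^{p+1}$ on $U$, the local error at $t$ is $$h^{p+1}\sum_{j=0}^{p-2}e_j\,J(q(t))^j\,r_{p-j}(t)+O(h^{p+2})\quad\text{uniformly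 in } t,\qquad r_k(t)=\frac{d^k}{ds^k}R_{q(t)}(q(s))\Big|_{s=t},$$ and if any method of local order $p$ with a coefficient matrix of the same size has such an expansion with coefficients $e'_j$, then $|e_j|\le|e'_j|$ for every $j$. -/

import Mathlib

open Set

noncomputable section

namespace EPI

/-- State space of a system of `d` ordinary differential equations. -/
abbrev State (d : ℕ) := EuclideanSpace ℝ (Fin d)

/-- The entire function `φ_k` of a matrix (a linear operator) through its power series,
`φ_k(L) = ∑ n, L ^ n / (n + k)!`. -/
def phi {d : ℕ} (k : ℕ) (L : State d →L[ℝ] State d) : State d →L[ℝ] State d :=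
  ∑' n : ℕ, (((n + k).factorial : ℝ)⁻¹) • L ^ n

/-- The series defining `φ_k(L)` converges for every `L`. -/
theorem phi_summable {d : ℕ} (k : ℕ) (L : State d →L[ℝ] State d) :
    Summable fun n : ℕ => (((n + k).factorial : ℝ)⁻¹) • L ^ n := by
  refine Summable.of_norm_bounded (g := fun n : ℕ => ‖((n.factorial : ℝ)⁻¹) • L ^ n‖)
    (NormedSpace.norm_expSeries_summable' (𝕂 := ℝ) L) fun n => ?_
  rw [norm_smul, norm_smul]
  refine mul_le_mul_of_nonneg_right ?_ (norm_nonneg _)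
  rw [norm_inv, norm_inv, Real.norm_natCast, Real.norm_natCast]
  have h : n.factorial ≤ (n + k).factorial := Nat.factorial_le (Nat.le_add_right n k)
  have h0 : (0 : ℝ) < n.factorial := by exact_mod_cast n.factorial_pos
  exact inv_anti₀ h0 (by exact_mod_cast h)

/-- The remainder `R(y) = F(y) - F(x) - F'(x) (y - x)` of the first-order Taylor expansion of the
vector field `F` at `x`. -/
def remainder {d : ℕ} (F : State d → State d) (x y : State d) : State d :=
  F y - F x - fderiv ℝ F x (y - x)

/-- One step of size `h` of the multistep exponential propagation iterative method with
coefficient matrix `A`. Here `x` is the current value `q_n`, and `prev i` is `q_{n-(i+1)}`; since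
`Fin M` and `Fin P` count from zero, `A m i` is the coefficient `α_{m+1,i+1}`. The value is
`q_n + φ_1(h J) h F(q_n) + ∑_m φ_m(h J) v_m`, where `v_m = ∑_i α_{m,i} h R(q_{n-i})`
and `J = F'(q_n)`. -/
def step {d M P : ℕ} (A : Matrix (Fin M) (Fin P) ℝ) (F : State d → State d) (h : ℝ)
    (x : State d) (prev : Fin P → State d) : State d :=
  x + phi 1 (h • fderiv ℝ F x) (h • F x) +
    ∑ m : Fin M, phi ((m : ℕ) + 1) (h • fderiv ℝ F x)
      (∑ i : Fin P, A m i • h • remainder F x (prev i))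

/-- `q` solves `q' = F(q)` on `[t₀, t₁]` and stays in the open set `U`, on which the
vector field `F` is of class `C^k`. -/
structure IsSolution {d : ℕ} (k : ℕ) (U : Set (State d)) (F : State d → State d)
    (t₀ t₁ : ℝ) (q : ℝ → State d) : Prop where
  isOpen : IsOpen U
  smooth : ContDiffOn ℝ k F U
  mem : ∀ t ∈ Icc t₀ t₁, q t ∈ U
  ode : ∀ t ∈ Icc t₀ t₁, HasDerivWithinAt q (F (q t)) (Icc t₀ t₁) t

/-- The local error at time `t`: the result of one step that starts from exact values
of the solution `q` at `t, t - h, …, t - P h`, minus the exact value `q (t + h)`. -/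
def localError {d M P : ℕ} (A : Matrix (Fin M) (Fin P) ℝ) (F : State d → State d)
    (q : ℝ → State d) (h t : ℝ) : State d :=
  step A F h (q t) (fun i => q (t - ((i : ℕ) + 1 : ℝ) * h)) - q (t + h)

/-- Consistency of order `p`: for every system with right-hand side of class `C^p`, the local error
is at most `C h ^ (p + 1)`, uniformly in the time at which the step is taken. -/
def HasLocalOrder {M P : ℕ} (A : Matrix (Fin M) (Fin P) ℝ) (p : ℕ) : Prop :=
  ∀ (d : ℕ) (U : Set (State d)) (F : State d → State d) (t₀ t₁ : ℝ) (q : ℝ → State d),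
    IsSolution p U F t₀ t₁ q →
    ∃ C h₀ : ℝ, 0 < h₀ ∧ ∀ h t : ℝ, 0 < h → h ≤ h₀ → t₀ ≤ t - P * h → t + h ≤ t₁ →
      ‖localError A F q h t‖ ≤ C * h ^ (p + 1)

/-- Convergence of order `p`: for every system with right-hand side of class `C^p`, if the
starting values `Q 0, …, Q P` have errors at most `C₀ h ^ p` and the later values `Q (n + 1)` are
computed by the method with constant step `h`, then for all small `h` every `Q n` with
`t₀ + n h ≤ t₁` has error at most `C h ^ p`, where `C` is independent of `h`, `n` and `Q`. -/
def HasGlobalOrder {M P : ℕ} (A : Matrix (Fin M) (Fin P) ℝ) (p : ℕ) : Prop :=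
  ∀ (d : ℕ) (U : Set (State d)) (F : State d → State d) (t₀ t₁ : ℝ) (q : ℝ → State d),
    IsSolution p U F t₀ t₁ q →
    ∀ C₀ : ℝ, ∃ C h₀ : ℝ, 0 < h₀ ∧ ∀ (h : ℝ) (Q : ℕ → State d), 0 < h → h ≤ h₀ →
      (∀ n : ℕ, n ≤ P → t₀ + n * h ≤ t₁ → ‖Q n - q (t₀ + n * h)‖ ≤ C₀ * h ^ p) →
      (∀ n : ℕ, P ≤ n → t₀ + ((n : ℝ) + 1) * h ≤ t₁ →
        Q (n + 1) = step A F h (Q n) (fun i => Q (n - ((i : ℕ) + 1)))) →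
      ∀ n : ℕ, t₀ + n * h ≤ t₁ → ‖Q n - q (t₀ + n * h)‖ ≤ C * h ^ p

/-- The vector `r_k`, the `k`-th time derivative at `t` of the remainder (of `F` at `q t`) along the
solution. The vectors `J ^ j r_k` with `2 ≤ k` and `j + k = p` are sums, with positive weights,
of the elementary differentials of `F` of order `p + 1` at `q t` (for different `j`, over
disjoint sets of rooted trees). -/
def remainderDeriv {d : ℕ} (F : State d → State d) (t₀ t₁ : ℝ) (q : ℝ → State d) (k : ℕ)
    (t : ℝ) : State d :=
  iteratedDerivWithin k (fun s => remainder F (q t) (q s)) (Icc t₀ t₁) t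

/-- The term of order `p + 1` of the local error has the coefficients `e`: the local error is
`h ^ (p + 1) ∑_{j ≤ p - 2} e_j J ^ j r_{p-j} + O(h ^ (p + 2))`, where `J = F'(q t)`. -/
def HasLeadingError {M P : ℕ} (A : Matrix (Fin M) (Fin P) ℝ) (p : ℕ) (e : Fin (p - 1) → ℝ) :
    Prop :=
  ∀ (d : ℕ) (U : Set (State d)) (F : State d → State d) (t₀ t₁ : ℝ) (q : ℝ → State d),
    IsSolution (p + 1) U F t₀ t₁ q →
    ∃ C h₀ : ℝ, 0 < h₀ ∧ ∀ h t : ℝ, 0 < h → h ≤ h₀ → t₀ ≤ t - P * h → t + h ≤ t₁ →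
      ‖localError A F q h t - h ^ (p + 1) • ∑ j : Fin (p - 1),
        e j • (fderiv ℝ F (q t) ^ (j : ℕ)) (remainderDeriv F t₀ t₁ q (p - (j : ℕ)) t)‖
        ≤ C * h ^ (p + 2)

/-- The coefficients of the leading term of the local error of `A` are, one by one, of the smallest
magnitude among all methods of order `p` with a coefficient matrix of the same size. -/
def MinimizesLeadingError {M P : ℕ} (A : Matrix (Fin M) (Fin P) ℝ) (p : ℕ) : Prop :=
  ∃ e : Fin (p - 1) → ℝ, HasLeadingError A p e ∧
    ∀ (A' : Matrix (Fin M) (Fin P) ℝ) (e' : Fin (p - 1) → ℝ),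
      HasLocalOrder A' p → HasLeadingError A' p e' → ∀ j, |e j| ≤ |e' j|

/-- The coefficient matrix of EPI4. -/
def A₄ : Matrix (Fin 3) (Fin 2) ℝ :=
  !![0, 0;
     -3 / 10, 3 / 40;
     32 / 5, -11 / 10]

/-- The coefficient matrix of EPI5. -/
def A₅ : Matrix (Fin 4) (Fin 3) ℝ :=
  !![0, 0, 0;
     -4 / 5, 2 / 5, -4 / 45;
     12, -9 / 2, 8 / 9;
     3, 0, -1 / 3]

/-- The coefficient matrix of EPI6. -/
def A₆ : Matrix (Fin 4) (Fin 4) ℝ :=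
  !![0, 0, 0, 0;
     -49 / 60, 351 / 560, -359 / 1260, 367 / 6720;
     92 / 7, -99 / 14, 176 / 63, -1 / 2;
     485 / 21, -151 / 14, 23 / 9, -31 / 168]

end EPI

end

/-!
Write `J` for the Jacobian of `F` at `x = q t`, `R` for the remainder of `F` at `x`, and `r_k` for
the `k`-th derivative of `R ∘ q` at `t`; then `r_0 = r_1 = 0`. The solution satisfies
`q' = F x + J (q - x) + R q`, so differentiating repeatedly gives
`q^(k+1) (t) = J^k F x + ∑_{i ≤ k} J^(k-i) r_i`. Inserting this into Taylor's formula for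
`q (t + h)`, Taylor's formula for `R (q (t - i h))` and the partial sums of `φ_m (h J)` into the
method, the contributions of `F x` cancel and the local error becomes
`∑_{k, j} c_{j,k} h^(1+k+j) J^j r_k`, where
`c_{j,k} = (1 / k!) ∑_{m,i} α_{m,i} (-i)^k / (j+m)! - 1 / (k+j+1)!`, with an error that is uniform
in `t` (`IsSolution.isBigO_localError_sub`). Thus the conditions `c_{j,k} = 0` for `2 ≤ k`,
`j + k < p` are sufficient for local order `p`, and the coefficients of the leading term are
`e_j = c_{j,p-j}`.

These facts have a converse: on the planar system `τ' = 1`, `z' = z + τ^k / k!` one has `r_i = 0`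
at time `0` for `i ≠ k`, and `J` fixes the nonzero vector `r_k`, so that all `c_{j,k}` with this
`k` can be read off from the local error at time `0` (`HasLocalOrder.orderCoeff_eq_zero`,
`HasLeadingError.eq_orderCoeff`).

Global order `p` follows from local order `p` by a discrete Gronwall argument, as the increment of
the method is Lipschitz near the solution with a constant proportional to `h`
(`HasLocalOrder.hasGlobalOrder`). For `τ' = 1`, `z' = τ^p / p!` the local errors are `e_0 h^(p+1)`
up to higher order and simply add up, so the global order is not `p + 1` when `e_0 ≠ 0`
(`HasLeadingError.not_hasGlobalOrder`).

In the three methods `p = P + 2`, `e_j = 0` for `j ≥ 1`, and `e_0 ≠ 0`. The conditions with `j = 0`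
say that the numbers `∑_m α_{m,i} / m!` are the weights of a quadrature formula with `P` given
nodes, exact on `P` consecutive powers; they determine these weights, and hence `e_0`, so that no
other method of the same size and order has a smaller `|e_0|` (`orderCoeff_zero_left_unique`).
-/

noncomputable section

open Filter Topology Asymptotics

namespace EPI

/-! ### Taylor expansion along a tower of derivatives -/

section Taylor

variable {E : Type*} [NormedAddCommGroup E] [NormedSpace ℝ E]

/-- Taylor's theorem with a bound for the remainder, about an arbitrary point of a convex set and in
both directions; the derivatives are given as a sequence `g`. -/
theorem norm_sub_taylor_le {s : Set ℝ} (hs : Convex ℝ s) {B : ℝ} {t : ℝ} (ht : t ∈ s) (n : ℕ)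
    (g : ℕ → ℝ → E) (hg : ∀ k < n, ∀ x ∈ s, HasDerivWithinAt (g k) (g (k + 1) x) s x)
    (hB : ∀ x ∈ s, ‖g n x‖ ≤ B) {x : ℝ} (hx : x ∈ s) :
    ‖g 0 x - ∑ k ∈ Finset.range n, ((x - t) ^ k / (k.factorial : ℝ)) • g k t‖
      ≤ B * |x - t| ^ n := by
  induction n generalizing g x with
  | zero => simpa using hB x hx
  | succ n ih =>
    have hB0 : 0 ≤ B := (norm_nonneg _).trans (hB t ht)
    have hsub : uIcc t x ⊆ s := hs.ordConnected.uIcc_subset ht hx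
    set f : ℝ → E := fun y =>
      g 0 y - ∑ k ∈ Finset.range (n + 1), ((y - t) ^ k / (k.factorial : ℝ)) • g k t with hf
    set f' : ℝ → E := fun y =>
      g 1 y - ∑ k ∈ Finset.range n, ((y - t) ^ k / (k.factorial : ℝ)) • g (k + 1) t with hf'
    have hd : ∀ y ∈ uIcc t x, HasDerivWithinAt f (f' y) (uIcc t x) y := by
      intro y hy
      refine ((hg 0 (Nat.succ_pos n) y (hsub hy)).mono hsub).sub ?_
      simp only [Finset.sum_range_succ', pow_zero, Nat.factorial_zero, Nat.cast_one, div_one,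
        one_smul]
      refine HasDerivWithinAt.add_const _ (HasDerivWithinAt.fun_sum fun k _ => ?_)
      have h1 : HasDerivWithinAt (fun y : ℝ => (y - t) ^ (k + 1) / ((k + 1).factorial : ℝ))
          ((y - t) ^ k / (k.factorial : ℝ)) (uIcc t x) y := by
        have h2 := (((hasDerivWithinAt_id y (uIcc t x)).sub_const t).pow (k + 1)).div_const
          ((k + 1).factorial : ℝ)
        refine h2.congr_deriv ?_
        rw [Nat.factorial_succ]
        have : (k.factorial : ℝ) ≠ 0 := by positivity
        push_cast
        simp only [id]
        field_simp
      exact h1.smul_const _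
    have hb : ∀ y ∈ uIcc t x, ‖f' y‖ ≤ B * |x - t| ^ n := by
      intro y hy
      refine (ih (fun k => g (k + 1)) (fun k hk => hg (k + 1) (by omega)) hB (hsub hy)).trans ?_
      have : |y - t| ≤ |x - t| := abs_sub_left_of_mem_uIcc hy
      gcongr
    have := (convex_uIcc t x).norm_image_sub_le_of_norm_hasDerivWithin_le hd hb
      left_mem_uIcc right_mem_uIcc
    have h0 : f t = 0 := by
      simp [hf, Finset.sum_range_succ']
    rw [h0, sub_zero, Real.norm_eq_abs, mul_assoc, ← pow_succ] at this
    exact this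

/-- A sequence of successive derivatives consists of the iterated derivatives. -/
theorem iteratedDerivWithin_eq_of_tower {s : Set ℝ} (hs : UniqueDiffOn ℝ s) (n : ℕ)
    (g : ℕ → ℝ → E) (hg : ∀ k < n, ∀ x ∈ s, HasDerivWithinAt (g k) (g (k + 1) x) s x)
    {x : ℝ} (hx : x ∈ s) : iteratedDerivWithin n (g 0) s x = g n x := by
  induction n generalizing x with
  | zero => simp
  | succ n ih =>
    rw [iteratedDerivWithin_succ]
    have h := fun y (hy : y ∈ s) => ih (fun k hk => hg k (by omega)) hy
    rw [derivWithin_congr h (h x hx)]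
    exact (hg n (Nat.lt_succ_self n) x hx).derivWithin (hs x hx)

end Taylor

/-! ### Estimates for the functions `φ_k` -/

section Phi

variable {d : ℕ}

theorem norm_pow_le_pow_norm (L : State d →L[ℝ] State d) (n : ℕ) : ‖L ^ n‖ ≤ ‖L‖ ^ n := by
  rcases Nat.eq_zero_or_pos n with rfl | hn
  · rw [pow_zero, pow_zero]; exact ContinuousLinearMap.norm_id_le
  · exact norm_pow_le' L hn

theorem norm_phi_sub_sum_le (m n : ℕ) (L : State d →L[ℝ] State d) :
    ‖phi m L - ∑ j ∈ Finset.range n, (((j + m).factorial : ℝ)⁻¹) • L ^ j‖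
      ≤ ‖L‖ ^ n * Real.exp ‖L‖ := by
  rw [phi, ← (phi_summable m L).sum_add_tsum_nat_add n, add_sub_cancel_left]
  have hexp : HasSum (fun j : ℕ => ‖L‖ ^ n * (‖L‖ ^ j / (j.factorial : ℝ)))
      (‖L‖ ^ n * Real.exp ‖L‖) := by
    rw [Real.exp_eq_exp_ℝ]
    exact (NormedSpace.expSeries_div_hasSum_exp (‖L‖)).mul_left _
  refine tsum_of_norm_bounded hexp fun j => ?_
  rw [norm_smul, norm_inv, Real.norm_natCast]
  have h1 : ‖L ^ (j + n)‖ ≤ ‖L‖ ^ n * ‖L‖ ^ j := by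
    rw [← pow_add, add_comm n j]; exact norm_pow_le_pow_norm L _
  have h2 : (((j + n + m).factorial : ℝ))⁻¹ ≤ (j.factorial : ℝ)⁻¹ := by
    have : j.factorial ≤ (j + n + m).factorial := Nat.factorial_le (by omega)
    have h0 : (0 : ℝ) < j.factorial := by positivity
    exact inv_anti₀ h0 (by exact_mod_cast this)
  calc (((j + n + m).factorial : ℝ))⁻¹ * ‖L ^ (j + n)‖
      ≤ (j.factorial : ℝ)⁻¹ * (‖L‖ ^ n * ‖L‖ ^ j) := by gcongr
    _ = _ := by ring

theorem norm_phi_le (m : ℕ) (L : State d →L[ℝ] State d) : ‖phi m L‖ ≤ Real.exp ‖L‖ := by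
  simpa using norm_phi_sub_sum_le m 0 L

theorem norm_pow_sub_pow_le {r : ℝ} {K L : State d →L[ℝ] State d} (hK : ‖K‖ ≤ r) (hL : ‖L‖ ≤ r)
    (n : ℕ) : ‖K ^ (n + 1) - L ^ (n + 1)‖ ≤ (n + 1) * r ^ n * ‖K - L‖ := by
  have hr : 0 ≤ r := (norm_nonneg _).trans hK
  induction n with
  | zero => simp
  | succ n ih =>
    have h : K ^ (n + 1 + 1) - L ^ (n + 1 + 1)
        = K * (K ^ (n + 1) - L ^ (n + 1)) + (K - L) * L ^ (n + 1) := by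
      rw [pow_succ' K (n + 1), pow_succ' L (n + 1), mul_sub, sub_mul]; abel
    have hLn : ‖L ^ (n + 1)‖ ≤ r ^ (n + 1) :=
      (norm_pow_le_pow_norm L _).trans (pow_le_pow_left₀ (norm_nonneg _) hL _)
    calc ‖K ^ (n + 1 + 1) - L ^ (n + 1 + 1)‖
        ≤ ‖K‖ * ‖K ^ (n + 1) - L ^ (n + 1)‖ + ‖K - L‖ * ‖L ^ (n + 1)‖ := by
          rw [h]; exact (norm_add_le _ _).trans (add_le_add (norm_mul_le _ _) (norm_mul_le _ _))
      _ ≤ r * ((n + 1) * r ^ n * ‖K - L‖) + ‖K - L‖ * r ^ (n + 1) := by gcongr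
      _ = _ := by push_cast; ring

/-- The functions `φ_m` are Lipschitz on bounded sets of operators. -/
theorem norm_phi_sub_phi_le (m : ℕ) {r : ℝ} {K L : State d →L[ℝ] State d} (hK : ‖K‖ ≤ r)
    (hL : ‖L‖ ≤ r) : ‖phi m K - phi m L‖ ≤ Real.exp r * ‖K - L‖ := by
  have hr : 0 ≤ r := (norm_nonneg _).trans hK
  have hexp : HasSum (fun j : ℕ => r ^ j / (j.factorial : ℝ) * ‖K - L‖)
      (Real.exp r * ‖K - L‖) := by
    rw [Real.exp_eq_exp_ℝ]
    exact (NormedSpace.expSeries_div_hasSum_exp r).mul_right _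
  have hsum := (phi_summable m K).sub (phi_summable m L)
  rw [phi, phi, ← (phi_summable m K).tsum_sub (phi_summable m L), hsum.tsum_eq_zero_add]
  simp only [pow_zero, sub_self, zero_add]
  refine tsum_of_norm_bounded hexp fun j => ?_
  have h1 : (((j + 1 + m).factorial : ℝ)⁻¹) • K ^ (j + 1) - (((j + 1 + m).factorial : ℝ)⁻¹) •
      L ^ (j + 1) = (((j + 1 + m).factorial : ℝ)⁻¹) • (K ^ (j + 1) - L ^ (j + 1)) :=
    (smul_sub _ _ _).symm
  rw [h1, norm_smul, norm_inv, Real.norm_natCast]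
  have h2 : (((j + 1 + m).factorial : ℝ))⁻¹ ≤ ((j + 1).factorial : ℝ)⁻¹ := by
    have : (j + 1).factorial ≤ (j + 1 + m).factorial := Nat.factorial_le (by omega)
    have h0 : (0 : ℝ) < (j + 1).factorial := by positivity
    exact inv_anti₀ h0 (by exact_mod_cast this)
  calc (((j + 1 + m).factorial : ℝ))⁻¹ * ‖K ^ (j + 1) - L ^ (j + 1)‖
      ≤ ((j + 1).factorial : ℝ)⁻¹ * ((j + 1) * r ^ j * ‖K - L‖) := by
        gcongr; exact norm_pow_sub_pow_le hK hL j
    _ = _ := by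
        rw [Nat.factorial_succ]
        have : (j.factorial : ℝ) ≠ 0 := by positivity
        push_cast
        field_simp

end Phi

/-! ### Asymptotics for small step sizes, uniformly in time -/

/-- The filter of pairs `(h, t)` of a step size tending to `0` from above and a time for which
the step from `t` to `t + h` and the `P` previous points stay inside `[t₀, t₁]`. An estimate along this
filter is uniform in the time. -/
def stepFilter (P : ℕ) (t₀ t₁ : ℝ) : Filter (ℝ × ℝ) :=
  comap Prod.fst (𝓝[>] 0) ⊓ 𝓟 {z | t₀ ≤ z.2 - P * z.1 ∧ z.2 + z.1 ≤ t₁}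

theorem eventually_stepFilter {P : ℕ} {t₀ t₁ : ℝ} {p : ℝ × ℝ → Prop} :
    (∀ᶠ z in stepFilter P t₀ t₁, p z) ↔ ∃ h₀ : ℝ, 0 < h₀ ∧ ∀ h t : ℝ, 0 < h → h ≤ h₀ →
      t₀ ≤ t - P * h → t + h ≤ t₁ → p (h, t) := by
  have hb : (stepFilter P t₀ t₁).HasBasis (fun h₀ : ℝ => 0 < h₀) fun h₀ =>
      Prod.fst ⁻¹' Ioc 0 h₀ ∩ {z | t₀ ≤ z.2 - P * z.1 ∧ z.2 + z.1 ≤ t₁} :=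
    ((nhdsGT_basis_Ioc (0 : ℝ)).comap _).inf_principal _
  rw [hb.eventually_iff]
  constructor
  · rintro ⟨h₀, h0, H⟩
    exact ⟨h₀, h0, fun h t h1 h2 h3 h4 => H ⟨⟨h1, h2⟩, h3, h4⟩⟩
  · rintro ⟨h₀, h0, H⟩
    exact ⟨h₀, h0, fun z hz => H z.1 z.2 hz.1.1 hz.1.2 hz.2.1 hz.2.2⟩

theorem isBigO_stepFilter_iff {E : Type*} [NormedAddCommGroup E] {P : ℕ} {t₀ t₁ : ℝ}
    {f : ℝ × ℝ → E} {n : ℕ} :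
    f =O[stepFilter P t₀ t₁] (fun z => z.1 ^ n) ↔
      ∃ C h₀ : ℝ, 0 < h₀ ∧ ∀ h t : ℝ, 0 < h → h ≤ h₀ → t₀ ≤ t - P * h → t + h ≤ t₁ →
        ‖f (h, t)‖ ≤ C * h ^ n := by
  rw [isBigO_iff]
  refine exists_congr fun C => ?_
  rw [eventually_stepFilter]
  refine exists_congr fun h₀ => and_congr_right fun _ => forall_congr' fun h =>
    forall_congr' fun t => forall_congr' fun hh => ?_
  simp only [norm_pow, Real.norm_eq_abs, abs_of_pos hh]

/-- If a polynomial of degree less than `n` is `O(h ^ n)` as `h` tends to `0` from above, then all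
of its coefficients vanish. -/
theorem coeff_eq_zero_of_abs_sum_le {n : ℕ} {a : ℕ → ℝ} {C h₀ : ℝ} (h0 : 0 < h₀)
    (H : ∀ h : ℝ, 0 < h → h ≤ h₀ → |∑ j ∈ Finset.range n, a j * h ^ j| ≤ C * h ^ n) :
    ∀ j < n, a j = 0 := by
  induction n generalizing a with
  | zero => intro j hj; omega
  | succ n ih =>
    have ha0 : a 0 = 0 := by
      have h1 : Tendsto (fun h : ℝ => |∑ j ∈ Finset.range (n + 1), a j * h ^ j|) (𝓝[>] 0)
          (𝓝 |∑ j ∈ Finset.range (n + 1), a j * 0 ^ j|) :=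
        ((by fun_prop : Continuous fun h : ℝ =>
          |∑ j ∈ Finset.range (n + 1), a j * h ^ j|).tendsto 0).mono_left nhdsWithin_le_nhds
      have h2 : Tendsto (fun h : ℝ => C * h ^ (n + 1)) (𝓝[>] 0) (𝓝 (C * 0 ^ (n + 1))) :=
        ((by fun_prop : Continuous fun h : ℝ => C * h ^ (n + 1)).tendsto 0).mono_left
          nhdsWithin_le_nhds
      have h3 := le_of_tendsto_of_tendsto h1 h2 (by
        filter_upwards [Ioc_mem_nhdsGT h0] with h hh using H h hh.1 hh.2)
      simpa [Finset.sum_range_succ'] using h3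
    intro j hj
    rcases j with _ | j
    · exact ha0
    refine ih (a := fun j => a (j + 1)) (fun h hh hh0 => ?_) j (by omega)
    have h4 := H h hh hh0
    have h5 : ∑ j ∈ Finset.range (n + 1), a j * h ^ j
        = h * ∑ j ∈ Finset.range n, a (j + 1) * h ^ j := by
      rw [Finset.sum_range_succ', ha0, Finset.mul_sum]
      simp only [zero_mul, add_zero]
      exact Finset.sum_congr rfl fun _ _ => by ring
    rw [h5, abs_mul, abs_of_pos hh] at h4
    have h6 : C * h ^ (n + 1) = h * (C * h ^ n) := by ring
    rw [h6] at h4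
    exact le_of_mul_le_mul_left h4 hh

/-! ### Regularity of the solution and of the remainder along it -/

section Expansion

variable {d : ℕ} {N : ℕ} {U : Set (State d)} {F : State d → State d} {t₀ t₁ : ℝ}
  {q : ℝ → State d}

theorem IsSolution.contDiffOn (hq : IsSolution N U F t₀ t₁ q) (ht : t₀ < t₁) :
    ContDiffOn ℝ (N + 1 : ℕ) q (Icc t₀ t₁) := by
  have hmem : MapsTo q (Icc t₀ t₁) U := hq.mem
  have h1 : ContDiffOn ℝ ((N : ℕ∞)) q (Icc t₀ t₁) := by
    refine ODE.contDiffOn_enat_Icc_of_hasDerivWithinAt (f := fun _ x => F x) (u := U) ?_ hq.ode hmem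
    exact hq.smooth.comp contDiffOn_snd fun z hz => hz.2
  have h2 : ContDiffOn ℝ N (fun s => F (q s)) (Icc t₀ t₁) := hq.smooth.comp h1 hmem
  have hu := uniqueDiffOn_Icc ht
  rw [Nat.cast_add, Nat.cast_one, contDiffOn_succ_iff_derivWithin hu]
  refine ⟨fun s hs => (hq.ode s hs).differentiableWithinAt, by simp, h2.congr fun s hs => ?_⟩
  exact (hq.ode s hs).derivWithin (hu s hs)

theorem IsSolution.hasDerivWithinAt_iteratedDerivWithin (hq : IsSolution N U F t₀ t₁ q)
    (ht : t₀ < t₁) {k : ℕ} (hk : k ≤ N) {s : ℝ} (hs : s ∈ Icc t₀ t₁) :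
    HasDerivWithinAt (iteratedDerivWithin k q (Icc t₀ t₁))
      (iteratedDerivWithin (k + 1) q (Icc t₀ t₁) s) (Icc t₀ t₁) s := by
  rw [iteratedDerivWithin_succ]
  exact (((hq.contDiffOn ht).differentiableOn_iteratedDerivWithin
    (by exact_mod_cast Nat.lt_succ_of_le hk) (uniqueDiffOn_Icc ht)) s hs).hasDerivWithinAt

theorem IsSolution.iteratedDerivWithin_one (hq : IsSolution N U F t₀ t₁ q)
    (ht : t₀ < t₁) {s : ℝ} (hs : s ∈ Icc t₀ t₁) :
    iteratedDerivWithin 1 q (Icc t₀ t₁) s = F (q s) := by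
  rw [_root_.iteratedDerivWithin_one]
  exact (hq.ode s hs).derivWithin (uniqueDiffOn_Icc ht s hs)

theorem IsSolution.hasFDerivAt (hq : IsSolution N U F t₀ t₁ q) (hN : 1 ≤ N) {x : State d}
    (hx : x ∈ U) : HasFDerivAt F (fderiv ℝ F x) x :=
  ((hq.smooth.contDiffAt (hq.isOpen.mem_nhds hx)).differentiableAt
    (by exact_mod_cast (by omega : N ≠ 0))).hasFDerivAt

theorem IsSolution.iteratedDerivWithin_two (hq : IsSolution N U F t₀ t₁ q) (hN : 1 ≤ N)
    (ht : t₀ < t₁) {s : ℝ} (hs : s ∈ Icc t₀ t₁) :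
    iteratedDerivWithin 2 q (Icc t₀ t₁) s = fderiv ℝ F (q s) (F (q s)) := by
  rw [iteratedDerivWithin_succ,
    derivWithin_congr (fun y hy => hq.iteratedDerivWithin_one ht hy)
      (hq.iteratedDerivWithin_one ht hs)]
  exact ((hq.hasFDerivAt hN (hq.mem s hs)).comp_hasDerivWithinAt s (hq.ode s hs)).derivWithin
    (uniqueDiffOn_Icc ht s hs)

/-- The successive derivatives of `s ↦ R (q s)`, where `R` is the remainder of `F` at `q t`, in
terms of the derivatives of the solution. -/
def remainderTower (F : State d → State d) (t₀ t₁ : ℝ) (q : ℝ → State d) (t : ℝ) :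
    ℕ → ℝ → State d
  | 0 => fun s => remainder F (q t) (q s)
  | k + 1 => fun s => iteratedDerivWithin (k + 2) q (Icc t₀ t₁) s -
      fderiv ℝ F (q t) (iteratedDerivWithin (k + 1) q (Icc t₀ t₁) s)

theorem IsSolution.hasDerivWithinAt_remainderTower (hq : IsSolution N U F t₀ t₁ q)
    (ht : t₀ < t₁) (t : ℝ) {k : ℕ} (hk : k < N) {s : ℝ} (hs : s ∈ Icc t₀ t₁) :
    HasDerivWithinAt (remainderTower F t₀ t₁ q t k) (remainderTower F t₀ t₁ q t (k + 1) s)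
      (Icc t₀ t₁) s := by
  rcases k with _ | k
  · have h1 := hq.hasDerivWithinAt_iteratedDerivWithin ht (k := 1) hk hs
    have h2 : HasDerivWithinAt (fun s => F (q s)) (iteratedDerivWithin 2 q (Icc t₀ t₁) s)
        (Icc t₀ t₁) s :=
      h1.congr (fun y hy => (hq.iteratedDerivWithin_one ht hy).symm)
        (hq.iteratedDerivWithin_one ht hs).symm
    have h3 := (fderiv ℝ F (q t)).hasFDerivAt.comp_hasDerivWithinAt s
      ((hq.ode s hs).sub_const (q t))
    simp only [remainderTower, hq.iteratedDerivWithin_one ht hs]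
    exact (h2.sub_const (F (q t))).sub h3
  · exact (hq.hasDerivWithinAt_iteratedDerivWithin ht (k := k + 2) hk hs).sub
      ((fderiv ℝ F (q t)).hasFDerivAt.comp_hasDerivWithinAt s
        (hq.hasDerivWithinAt_iteratedDerivWithin ht (k := k + 1) (by omega) hs))

theorem IsSolution.remainderDeriv_eq_tower (hq : IsSolution N U F t₀ t₁ q)
    (ht : t₀ < t₁) {k : ℕ} (hk : k ≤ N) {t : ℝ} (hs : t ∈ Icc t₀ t₁) :
    remainderDeriv F t₀ t₁ q k t = remainderTower F t₀ t₁ q t k t :=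
  iteratedDerivWithin_eq_of_tower (uniqueDiffOn_Icc ht) k (remainderTower F t₀ t₁ q t)
    (fun _ hj _ hx => hq.hasDerivWithinAt_remainderTower ht t (by omega) hx) hs

theorem remainderDeriv_zero (t : ℝ) : remainderDeriv F t₀ t₁ q 0 t = 0 := by
  simp [remainderDeriv, remainder]

theorem IsSolution.remainderDeriv_one (hq : IsSolution N U F t₀ t₁ q) (hN : 1 ≤ N)
    (ht : t₀ < t₁) {t : ℝ} (hs : t ∈ Icc t₀ t₁) : remainderDeriv F t₀ t₁ q 1 t = 0 := by
  rw [hq.remainderDeriv_eq_tower ht hN hs]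
  simp [remainderTower, hq.iteratedDerivWithin_two hN ht hs, hq.iteratedDerivWithin_one ht hs,
    -_root_.iteratedDerivWithin_one]

/-- Repeated differentiation of the equation, linearised at `q t`, expresses the derivatives of the
solution through `F (q t)` and the vectors `r_k`. -/
theorem IsSolution.iteratedDerivWithin_succ_eq (hq : IsSolution N U F t₀ t₁ q)
    (ht : t₀ < t₁) {t : ℝ} (hs : t ∈ Icc t₀ t₁) {k : ℕ} (hk : k ≤ N) :
    iteratedDerivWithin (k + 1) q (Icc t₀ t₁) t = (fderiv ℝ F (q t) ^ k) (F (q t)) +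
      ∑ i ∈ Finset.range (k + 1),
        (fderiv ℝ F (q t) ^ (k - i)) (remainderDeriv F t₀ t₁ q i t) := by
  induction k with
  | zero => simp [hq.iteratedDerivWithin_one ht hs, remainderDeriv_zero,
      -_root_.iteratedDerivWithin_one]
  | succ k ih =>
    have h1 : iteratedDerivWithin (k + 1 + 1) q (Icc t₀ t₁) t
        = fderiv ℝ F (q t) (iteratedDerivWithin (k + 1) q (Icc t₀ t₁) t)
          + remainderDeriv F t₀ t₁ q (k + 1) t := by
      rw [hq.remainderDeriv_eq_tower ht hk hs]
      simp [remainderTower]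
    have h2 : ∀ i ∈ Finset.range (k + 1),
        (fderiv ℝ F (q t) ^ (k + 1 - i)) (remainderDeriv F t₀ t₁ q i t)
        = fderiv ℝ F (q t) ((fderiv ℝ F (q t) ^ (k - i)) (remainderDeriv F t₀ t₁ q i t)) := by
      intro i hi
      have : k + 1 - i = (k - i) + 1 := by have := Finset.mem_range.1 hi; omega
      rw [this, pow_succ']; rfl
    rw [h1, ih (by omega), Finset.sum_range_succ _ (k + 1), Finset.sum_congr rfl h2, map_add,
      map_sum, pow_succ', Nat.sub_self, pow_zero]
    simp only [mul_apply_eq_comp, one_apply_eq_self]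
    abel

/-- A common bound for the derivatives of the solution and for the Jacobian along it. -/
theorem IsSolution.exists_bound (hq : IsSolution N U F t₀ t₁ q) (hN : 1 ≤ N) (ht : t₀ < t₁) :
    ∃ B : ℝ, 0 ≤ B ∧ (∀ k ≤ N + 1, ∀ s ∈ Icc t₀ t₁, ‖iteratedDerivWithin k q (Icc t₀ t₁) s‖ ≤ B) ∧
      ∀ s ∈ Icc t₀ t₁, ‖fderiv ℝ F (q s)‖ ≤ B := by
  have h1 : ∀ k, ∃ B : ℝ, k ≤ N + 1 →
      ∀ s ∈ Icc t₀ t₁, ‖iteratedDerivWithin k q (Icc t₀ t₁) s‖ ≤ B := by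
    intro k
    by_cases hk : k ≤ N + 1
    · obtain ⟨B, hB⟩ := isCompact_Icc.exists_bound_of_continuousOn
        ((hq.contDiffOn ht).continuousOn_iteratedDerivWithin (by exact_mod_cast hk)
          (uniqueDiffOn_Icc ht))
      exact ⟨B, fun _ => hB⟩
    · exact ⟨0, fun h => absurd h hk⟩
  choose B hB using h1
  have hc : ContinuousOn (fun s => fderiv ℝ F (q s)) (Icc t₀ t₁) :=
    (hq.smooth.continuousOn_fderiv_of_isOpen hq.isOpen (by exact_mod_cast hN)).comp
      (hq.contDiffOn ht).continuousOn hq.mem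
  obtain ⟨B', hB'⟩ := isCompact_Icc.exists_bound_of_continuousOn hc
  have ha : ∀ k ≤ N + 1, |B k| ≤ ∑ k ∈ Finset.range (N + 2), |B k| := fun k hk =>
    Finset.single_le_sum (f := fun k => |B k|) (fun _ _ => abs_nonneg _)
      (Finset.mem_range.2 (by omega))
  refine ⟨∑ k ∈ Finset.range (N + 2), |B k| + |B'|, by positivity, fun k hk s hs => ?_,
    fun s hs => ?_⟩
  · have := hB k hk s hs
    linarith [ha k hk, le_abs_self (B k), abs_nonneg B']
  · have := hB' s hs
    have h0 : 0 ≤ ∑ k ∈ Finset.range (N + 2), |B k| := by positivity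
    linarith [le_abs_self B']

/-! ### Expansion of the local error -/

theorem clm_smul_pow (c : ℝ) (L : State d →L[ℝ] State d) (n : ℕ) :
    (c • L) ^ n = c ^ n • L ^ n := by
  induction n with
  | zero => simp
  | succ n ih =>
    ext1 v
    rw [pow_succ, ih, pow_succ, pow_succ]
    simp only [mul_apply_eq_comp, _root_.smul_apply, map_smul, smul_smul,
      mul_comm c]

theorem isBigO_clm_apply {α : Type*} {l : Filter α} {L : α → State d →L[ℝ] State d}
    {v : α → State d} {f g : α → ℝ} (hL : L =O[l] f) (hv : v =O[l] g) :
    (fun z => L z (v z)) =O[l] fun z => f z * g z :=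
  (IsBigO.of_bound 1 (Eventually.of_forall fun z => by
    rw [one_mul, norm_mul, norm_norm, norm_norm]
    exact (L z).le_opNorm (v z))).trans (hL.norm_left.mul hv.norm_left)

/-- The coefficient of `h ^ (1 + k + j) J ^ j r_k` in the expansion of the local error. -/
def orderCoeff {M P : ℕ} (A : Matrix (Fin M) (Fin P) ℝ) (j k : ℕ) : ℝ :=
  ∑ m : Fin M, ∑ i : Fin P, A m i * ((-((i : ℕ) + 1 : ℝ)) ^ k / (k.factorial : ℝ) *
    ((j + ((m : ℕ) + 1)).factorial : ℝ)⁻¹) - ((k + j + 1).factorial : ℝ)⁻¹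

variable {M P : ℕ}

theorem eventually_mem_stepFilter (P : ℕ) (t₀ t₁ : ℝ) :
    ∀ᶠ z in stepFilter P t₀ t₁, 0 < z.1 ∧ z.1 ≤ 1 ∧ z.2 ∈ Icc t₀ t₁ ∧ z.2 + z.1 ∈ Icc t₀ t₁ ∧
      ∀ i : Fin P, z.2 - ((i : ℕ) + 1 : ℝ) * z.1 ∈ Icc t₀ t₁ := by
  rw [eventually_stepFilter]
  refine ⟨1, one_pos, fun h t h0 h1 h2 h3 => ?_⟩
  have hP : (0 : ℝ) ≤ P * h := by positivity
  refine ⟨h0, h1, ⟨by linarith, by linarith⟩, ⟨by linarith, h3⟩, fun i => ⟨?_, ?_⟩⟩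
  · have : ((i : ℕ) + 1 : ℝ) ≤ P := by exact_mod_cast i.2
    have := mul_le_mul_of_nonneg_right this h0.le
    linarith
  · have : 0 ≤ ((i : ℕ) + 1 : ℝ) * h := by positivity
    linarith

theorem isBigO_fst_pow_of_le {E : Type*} [NormedAddCommGroup E] {f : ℝ × ℝ → E} {n : ℕ} {C : ℝ}
    (H : ∀ h t : ℝ, 0 < h → h ≤ 1 → t ∈ Icc t₀ t₁ → t + h ∈ Icc t₀ t₁ →
      (∀ i : Fin P, t - ((i : ℕ) + 1 : ℝ) * h ∈ Icc t₀ t₁) → ‖f (h, t)‖ ≤ C * h ^ n) :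
    f =O[stepFilter P t₀ t₁] fun z => z.1 ^ n := by
  refine IsBigO.of_bound C ?_
  filter_upwards [eventually_mem_stepFilter P t₀ t₁] with z hz
  rw [norm_pow, Real.norm_eq_abs, abs_of_pos hz.1]
  exact H z.1 z.2 hz.1 hz.2.1 hz.2.2.1 hz.2.2.2.1 hz.2.2.2.2

theorem IsSolution.isBigO_field (hq : IsSolution N U F t₀ t₁ q) (hN : 1 ≤ N) (ht : t₀ < t₁) :
    (fun z : ℝ × ℝ => F (q z.2)) =O[stepFilter P t₀ t₁] fun z => z.1 ^ 0 := by
  obtain ⟨B, -, hB, -⟩ := hq.exists_bound hN ht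
  refine isBigO_fst_pow_of_le (C := B) fun h t _ _ h2 _ _ => ?_
  have := hB 1 (by omega) t h2
  rw [hq.iteratedDerivWithin_one ht h2] at this
  simpa using this

theorem IsSolution.isBigO_remainderDeriv (hq : IsSolution N U F t₀ t₁ q) (hN : 1 ≤ N)
    (ht : t₀ < t₁) {k : ℕ} (hk : k ≤ N) :
    (fun z : ℝ × ℝ => remainderDeriv F t₀ t₁ q k z.2) =O[stepFilter P t₀ t₁] fun z => z.1 ^ 0 := by
  obtain ⟨B, hB0, hB, hJ⟩ := hq.exists_bound hN ht
  refine isBigO_fst_pow_of_le (C := B + B * B) fun h t _ _ h2 _ _ => ?_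
  rw [pow_zero, mul_one]
  dsimp only
  rcases k with _ | k
  · rw [remainderDeriv_zero, norm_zero]; positivity
  rw [hq.remainderDeriv_eq_tower ht hk h2]
  refine (norm_sub_le _ _).trans (add_le_add (hB _ (by omega) t h2) ?_)
  exact (ContinuousLinearMap.le_opNorm _ _).trans
    (mul_le_mul (hJ t h2) (hB _ (by omega) t h2) (norm_nonneg _) hB0)

theorem IsSolution.isBigO_phi_sub (hq : IsSolution N U F t₀ t₁ q) (hN : 1 ≤ N) (ht : t₀ < t₁)
    (m n : ℕ) :
    (fun z : ℝ × ℝ => phi m (z.1 • fderiv ℝ F (q z.2)) - ∑ j ∈ Finset.range n,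
      (((j + m).factorial : ℝ)⁻¹ * z.1 ^ j) • fderiv ℝ F (q z.2) ^ j)
      =O[stepFilter P t₀ t₁] fun z => z.1 ^ n := by
  obtain ⟨B, hB0, -, hB⟩ := hq.exists_bound hN ht
  refine isBigO_fst_pow_of_le (C := B ^ n * Real.exp B) fun h t h0 h1 h2 _ _ => ?_
  have h3 := norm_phi_sub_sum_le m n (h • fderiv ℝ F (q t))
  have h4 : ‖h • fderiv ℝ F (q t)‖ ≤ h * B := by
    rw [norm_smul, Real.norm_eq_abs, abs_of_pos h0]
    exact mul_le_mul_of_nonneg_left (hB t h2) h0.le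
  have h5 : h * B ≤ B := mul_le_of_le_one_left hB0 h1
  have h6 : ∀ j ∈ Finset.range n, (((j + m).factorial : ℝ)⁻¹) • (h • fderiv ℝ F (q t)) ^ j
      = (((j + m).factorial : ℝ)⁻¹ * h ^ j) • fderiv ℝ F (q t) ^ j := fun j _ => by
    rw [clm_smul_pow, smul_smul]
  rw [Finset.sum_congr rfl h6] at h3
  calc _ ≤ _ := h3
    _ ≤ (h * B) ^ n * Real.exp B := by
      gcongr
      exact h4.trans h5
    _ = _ := by ring

theorem IsSolution.isBigO_phi (hq : IsSolution N U F t₀ t₁ q) (hN : 1 ≤ N) (ht : t₀ < t₁)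
    (m : ℕ) :
    (fun z : ℝ × ℝ => phi m (z.1 • fderiv ℝ F (q z.2)))
      =O[stepFilter P t₀ t₁] fun z => z.1 ^ 0 := by
  simpa using hq.isBigO_phi_sub (P := P) hN ht m 0

theorem IsSolution.isBigO_remainder_sub (hq : IsSolution N U F t₀ t₁ q) (hN : 1 ≤ N)
    (ht : t₀ < t₁) (i : Fin P) :
    (fun z : ℝ × ℝ => remainder F (q z.2) (q (z.2 - ((i : ℕ) + 1 : ℝ) * z.1)) -
      ∑ k ∈ Finset.range N, ((-((i : ℕ) + 1 : ℝ)) ^ k / (k.factorial : ℝ) * z.1 ^ k) •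
        remainderDeriv F t₀ t₁ q k z.2) =O[stepFilter P t₀ t₁] fun z => z.1 ^ N := by
  obtain ⟨B, hB0, hB, hJ⟩ := hq.exists_bound hN ht
  refine isBigO_fst_pow_of_le (C := (B + B * B) * ((i : ℕ) + 1 : ℝ) ^ N)
    fun h t h0 h1 h2 _ h3 => ?_
  have hb : ∀ x ∈ Icc t₀ t₁, ‖remainderTower F t₀ t₁ q t N x‖ ≤ B + B * B := by
    intro x hx
    obtain ⟨n, rfl⟩ : ∃ n, N = n + 1 := ⟨N - 1, by omega⟩
    refine (norm_sub_le _ _).trans (add_le_add (hB _ (by omega) x hx) ?_)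
    exact (ContinuousLinearMap.le_opNorm _ _).trans
      (mul_le_mul (hJ t h2) (hB _ (by omega) x hx) (norm_nonneg _) hB0)
  have h4 := norm_sub_taylor_le (convex_Icc t₀ t₁) h2 N (remainderTower F t₀ t₁ q t)
    (fun k hk x hx => hq.hasDerivWithinAt_remainderTower ht t hk hx) hb (h3 i)
  have h5 : t - ((i : ℕ) + 1 : ℝ) * h - t = -((i : ℕ) + 1 : ℝ) * h := by ring
  have h6 : |-((i : ℕ) + 1 : ℝ) * h| = ((i : ℕ) + 1 : ℝ) * h := by
    rw [abs_mul, abs_neg, abs_of_pos h0, abs_of_pos (by positivity)]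
  rw [h5, h6] at h4
  have h7 : ∀ k ∈ Finset.range N, (((-((i : ℕ) + 1 : ℝ)) * h) ^ k / (k.factorial : ℝ)) •
      remainderTower F t₀ t₁ q t k t = ((-((i : ℕ) + 1 : ℝ)) ^ k / (k.factorial : ℝ) * h ^ k) •
        remainderDeriv F t₀ t₁ q k t := by
    intro k hk
    rw [hq.remainderDeriv_eq_tower ht (Finset.mem_range.1 hk).le h2, mul_pow, div_mul_eq_mul_div]
  rw [Finset.sum_congr rfl h7, mul_pow, ← mul_assoc] at h4
  exact h4

theorem IsSolution.isBigO_solution_sub (hq : IsSolution N U F t₀ t₁ q) (hN : 1 ≤ N)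
    (ht : t₀ < t₁) :
    (fun z : ℝ × ℝ => q (z.2 + z.1) - q z.2
      - ∑ j ∈ Finset.range N, (((j + 1).factorial : ℝ)⁻¹ * z.1 ^ (j + 1)) •
        (fderiv ℝ F (q z.2) ^ j) (F (q z.2))
      - ∑ k ∈ Finset.range N, ∑ j ∈ Finset.range (N - k),
        (((k + j + 1).factorial : ℝ)⁻¹ * z.1 ^ (k + j + 1)) •
          (fderiv ℝ F (q z.2) ^ j) (remainderDeriv F t₀ t₁ q k z.2))
      =O[stepFilter P t₀ t₁] fun z => z.1 ^ (N + 1) := by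
  obtain ⟨B, hB0, hB, hJ⟩ := hq.exists_bound hN ht
  refine isBigO_fst_pow_of_le (C := B) fun h t h0 h1 h2 h3 _ => ?_
  have h4 := norm_sub_taylor_le (convex_Icc t₀ t₁) h2 (N + 1)
    (fun k => iteratedDerivWithin k q (Icc t₀ t₁))
    (fun k hk x hx => hq.hasDerivWithinAt_iteratedDerivWithin ht (by omega) hx)
    (hB (N + 1) le_rfl) h3
  rw [add_sub_cancel_left, abs_of_pos h0] at h4
  have h5 : ∀ j ∈ Finset.range N, (h ^ (j + 1) / ((j + 1).factorial : ℝ)) •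
      iteratedDerivWithin (j + 1) q (Icc t₀ t₁) t
      = (((j + 1).factorial : ℝ)⁻¹ * h ^ (j + 1)) • (fderiv ℝ F (q t) ^ j) (F (q t)) +
        ∑ i ∈ Finset.range (j + 1), (((i + (j - i) + 1).factorial : ℝ)⁻¹ *
          h ^ (i + (j - i) + 1)) •
          (fderiv ℝ F (q t) ^ (j - i)) (remainderDeriv F t₀ t₁ q i t) := by
    intro j hj
    rw [hq.iteratedDerivWithin_succ_eq ht h2 (Finset.mem_range.1 hj).le, smul_add,
      Finset.smul_sum, div_eq_inv_mul]
    congr 1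
    refine Finset.sum_congr rfl fun i hi => ?_
    have : i + (j - i) = j := by have := Finset.mem_range.1 hi; omega
    rw [this]
  rw [Finset.sum_range_succ', Finset.sum_congr rfl h5, Finset.sum_add_distrib,
    Finset.sum_range_diag_flip N (fun i j => (((i + j + 1).factorial : ℝ)⁻¹ *
      h ^ (i + j + 1)) • (fderiv ℝ F (q t) ^ j) (remainderDeriv F t₀ t₁ q i t))] at h4
  simp only [iteratedDerivWithin_zero, pow_zero, Nat.factorial_zero, Nat.cast_one, div_one,
    one_smul] at h4
  refine le_trans (le_of_eq ?_) h4
  congr 1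
  abel

theorem isBigO_smul_pow {l : Filter (ℝ × ℝ)} {c : ℝ} {v : ℝ × ℝ → State d} {a b n : ℕ}
    (hv : v =O[l] fun z => z.1 ^ b) (hn : a + b = n) :
    (fun z => (c * z.1 ^ a) • v z) =O[l] fun z => z.1 ^ n := by
  have h1 : (fun z : ℝ × ℝ => c * z.1 ^ a) =O[l] fun z => z.1 ^ a :=
    (isBigO_refl _ _).const_mul_left c
  refine (h1.smul hv).congr_right fun z => ?_
  rw [smul_eq_mul, ← pow_add, hn]

theorem IsSolution.isBigO_phi_remainder_sub (hq : IsSolution N U F t₀ t₁ q) (hN : 1 ≤ N)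
    (ht : t₀ < t₁) (m : ℕ) (i : Fin P) :
    (fun z : ℝ × ℝ => phi m (z.1 • fderiv ℝ F (q z.2))
        (z.1 • remainder F (q z.2) (q (z.2 - ((i : ℕ) + 1 : ℝ) * z.1))) -
      ∑ k ∈ Finset.range N, ∑ j ∈ Finset.range (N - k),
        ((-((i : ℕ) + 1 : ℝ)) ^ k / (k.factorial : ℝ) * ((j + m).factorial : ℝ)⁻¹ *
          z.1 ^ (k + j + 1)) •
          (fderiv ℝ F (q z.2) ^ j) (remainderDeriv F t₀ t₁ q k z.2))
      =O[stepFilter P t₀ t₁] fun z => z.1 ^ (N + 1) := by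
  have h1 : (fun z : ℝ × ℝ => ((1 : ℝ) * z.1 ^ 1) • phi m (z.1 • fderiv ℝ F (q z.2))
      (remainder F (q z.2) (q (z.2 - ((i : ℕ) + 1 : ℝ) * z.1)) -
      ∑ k ∈ Finset.range N, ((-((i : ℕ) + 1 : ℝ)) ^ k / (k.factorial : ℝ) * z.1 ^ k) •
        remainderDeriv F t₀ t₁ q k z.2)) =O[stepFilter P t₀ t₁] fun z => z.1 ^ (N + 1) := by
    refine isBigO_smul_pow (b := N) ?_ (add_comm _ _)
    simpa using isBigO_clm_apply (hq.isBigO_phi hN ht m) (hq.isBigO_remainder_sub hN ht i)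
  have h2 : ∀ k ∈ Finset.range N, (fun z : ℝ × ℝ =>
      ((-((i : ℕ) + 1 : ℝ)) ^ k / (k.factorial : ℝ) * z.1 ^ (k + 1)) •
      ((phi m (z.1 • fderiv ℝ F (q z.2)) - ∑ j ∈ Finset.range (N - k),
      (((j + m).factorial : ℝ)⁻¹ * z.1 ^ j) • fderiv ℝ F (q z.2) ^ j)
        (remainderDeriv F t₀ t₁ q k z.2))) =O[stepFilter P t₀ t₁] fun z => z.1 ^ (N + 1) := by
    intro k hk
    have hk := Finset.mem_range.1 hk
    refine isBigO_smul_pow (b := N - k) ?_ (by omega)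
    simpa using isBigO_clm_apply (hq.isBigO_phi_sub hN ht m (N - k))
      (hq.isBigO_remainderDeriv hN ht hk.le)
  refine (h1.add (IsBigO.sum h2)).congr_left fun z => ?_
  simp only [one_mul, pow_one, map_sub, map_sum, map_smul, smul_sub, Finset.smul_sum,
    _root_.sub_apply, _root_.sum_apply, _root_.smul_apply,
    Finset.sum_sub_distrib, smul_smul, Finset.sum_apply]
  have e1 : ∀ k, z.1 * ((-((i : ℕ) + 1 : ℝ)) ^ k / (k.factorial : ℝ) * z.1 ^ k)
      = (-((i : ℕ) + 1 : ℝ)) ^ k / (k.factorial : ℝ) * z.1 ^ (k + 1) := fun k => by ring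
  have e2 : ∀ k j, (-((i : ℕ) + 1 : ℝ)) ^ k / (k.factorial : ℝ) * z.1 ^ (k + 1) *
      (((j + m).factorial : ℝ)⁻¹ * z.1 ^ j) = (-((i : ℕ) + 1 : ℝ)) ^ k / (k.factorial : ℝ) *
        ((j + m).factorial : ℝ)⁻¹ * z.1 ^ (k + j + 1) := fun k j => by ring
  simp only [e1, e2]
  abel

/-- The local error of an arbitrary coefficient matrix, expanded to order `N` for a vector field of
class `C^N`. The terms with `k = 0` and `k = 1` vanish since `r_0 = r_1 = 0`. -/
theorem IsSolution.isBigO_localError_sub (A : Matrix (Fin M) (Fin P) ℝ)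
    (hq : IsSolution N U F t₀ t₁ q) (hN : 1 ≤ N) (ht : t₀ < t₁) :
    (fun z : ℝ × ℝ => localError A F q z.1 z.2 -
      ∑ k ∈ Finset.range N, ∑ j ∈ Finset.range (N - k),
        (orderCoeff A j k * z.1 ^ (k + j + 1)) •
          (fderiv ℝ F (q z.2) ^ j) (remainderDeriv F t₀ t₁ q k z.2))
      =O[stepFilter P t₀ t₁] fun z => z.1 ^ (N + 1) := by
  have h1 : (fun z : ℝ × ℝ => ((1 : ℝ) * z.1 ^ 1) •
      ((phi 1 (z.1 • fderiv ℝ F (q z.2)) - ∑ j ∈ Finset.range N,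
      (((j + 1).factorial : ℝ)⁻¹ * z.1 ^ j) • fderiv ℝ F (q z.2) ^ j) (F (q z.2))))
        =O[stepFilter P t₀ t₁] fun z => z.1 ^ (N + 1) := by
    refine isBigO_smul_pow (b := N) ?_ (add_comm _ _)
    simpa using isBigO_clm_apply (hq.isBigO_phi_sub hN ht 1 N) (hq.isBigO_field hN ht)
  have h2 := IsBigO.sum (s := Finset.univ) fun (m : Fin M) _ =>
    IsBigO.sum (s := Finset.univ) fun (i : Fin P) _ =>
      (hq.isBigO_phi_remainder_sub hN ht ((m : ℕ) + 1) i).const_smul_left (A m i)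
  refine ((h1.add h2).sub (hq.isBigO_solution_sub hN ht)).congr_left fun z => ?_
  have e1 : ∑ k ∈ Finset.range N, ∑ j ∈ Finset.range (N - k),
        (orderCoeff A j k * z.1 ^ (k + j + 1)) •
          (fderiv ℝ F (q z.2) ^ j) (remainderDeriv F t₀ t₁ q k z.2)
      = ∑ m : Fin M, ∑ i : Fin P, A m i • ∑ k ∈ Finset.range N, ∑ j ∈ Finset.range (N - k),
        ((-((i : ℕ) + 1 : ℝ)) ^ k / (k.factorial : ℝ) * ((j + ((m : ℕ) + 1)).factorial : ℝ)⁻¹ *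
          z.1 ^ (k + j + 1)) •
          (fderiv ℝ F (q z.2) ^ j) (remainderDeriv F t₀ t₁ q k z.2)
        - ∑ k ∈ Finset.range N, ∑ j ∈ Finset.range (N - k),
        (((k + j + 1).factorial : ℝ)⁻¹ * z.1 ^ (k + j + 1)) •
          (fderiv ℝ F (q z.2) ^ j) (remainderDeriv F t₀ t₁ q k z.2) := by
    simp only [orderCoeff, sub_mul, sub_smul, Finset.sum_mul, Finset.sum_smul,
      Finset.sum_sub_distrib, Finset.smul_sum, smul_smul]
    congr 1
    have e3 : ∀ m : Fin M, ∑ i : Fin P, ∑ k ∈ Finset.range N, ∑ j ∈ Finset.range (N - k),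
        (A m i * ((-((i : ℕ) + 1 : ℝ)) ^ k / (k.factorial : ℝ) *
          ((j + ((m : ℕ) + 1)).factorial : ℝ)⁻¹ * z.1 ^ (k + j + 1))) •
          (fderiv ℝ F (q z.2) ^ j) (remainderDeriv F t₀ t₁ q k z.2)
        = ∑ k ∈ Finset.range N, ∑ j ∈ Finset.range (N - k), ∑ i : Fin P,
        (A m i * ((-((i : ℕ) + 1 : ℝ)) ^ k / (k.factorial : ℝ) *
          ((j + ((m : ℕ) + 1)).factorial : ℝ)⁻¹) * z.1 ^ (k + j + 1)) •
          (fderiv ℝ F (q z.2) ^ j) (remainderDeriv F t₀ t₁ q k z.2) := by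
      intro m
      rw [Finset.sum_comm]
      refine Finset.sum_congr rfl fun k _ => ?_
      rw [Finset.sum_comm]
      simp only [mul_assoc]
    rw [Finset.sum_congr rfl fun m _ => e3 m]
    symm
    rw [Finset.sum_comm]
    refine Finset.sum_congr rfl fun k _ => ?_
    rw [Finset.sum_comm]
  rw [e1]
  have e4 : ∀ j : ℕ, z.1 * (((j + 1).factorial : ℝ)⁻¹ * z.1 ^ j)
      = ((j + 1).factorial : ℝ)⁻¹ * z.1 ^ (j + 1) := fun j => by ring
  simp only [localError, step, Finset.sum_apply, Pi.smul_apply, map_sum, map_smul, smul_sub,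
    Finset.sum_sub_distrib, one_mul,
    pow_one, _root_.sub_apply, _root_.sum_apply,
    _root_.smul_apply, Finset.smul_sum, smul_smul, e4]
  abel

end Expansion

/-! ### Order conditions are sufficient -/

section Sufficiency

variable {M P : ℕ} {A : Matrix (Fin M) (Fin P) ℝ} {p : ℕ}

/-- A uniform estimate for small step sizes holds vacuously on a degenerate time interval. -/
theorem exists_bound_of_not_lt {t₀ t₁ : ℝ} (ht : ¬ t₀ < t₁) (f : ℝ → ℝ → ℝ) (n : ℕ) :
    ∃ C h₀ : ℝ, 0 < h₀ ∧ ∀ h t : ℝ, 0 < h → h ≤ h₀ → t₀ ≤ t - P * h → t + h ≤ t₁ →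
      f h t ≤ C * h ^ n := by
  refine ⟨0, 1, one_pos, fun h t h0 _ h2 h3 => absurd ?_ ht⟩
  have : (0 : ℝ) ≤ P * h := by positivity
  linarith

theorem hasLocalOrder_of_orderCoeff_eq_zero (hp : 1 ≤ p)
    (H : ∀ j k, 2 ≤ k → k + j < p → orderCoeff A j k = 0) : HasLocalOrder A p := by
  intro d U F t₀ t₁ q hq
  by_cases ht : t₀ < t₁
  · refine (isBigO_stepFilter_iff (f := fun z : ℝ × ℝ => localError A F q z.1 z.2)).1
      ((hq.isBigO_localError_sub A hp ht).congr' ?_ EventuallyEq.rfl)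
    filter_upwards [eventually_mem_stepFilter P t₀ t₁] with z hz
    rw [sub_eq_self]
    refine Finset.sum_eq_zero fun k hk => Finset.sum_eq_zero fun j hj => ?_
    rw [Finset.mem_range] at hk hj
    rcases k with _ | _ | k
    · rw [remainderDeriv_zero, map_zero, smul_zero]
    · rw [hq.remainderDeriv_one hp ht hz.2.2.1, map_zero, smul_zero]
    · rw [H j (k + 2) (by omega) (by omega), zero_mul, zero_smul]
  · exact exists_bound_of_not_lt ht (fun h t => ‖localError A F q h t‖) (p + 1)

theorem hasLeadingError_of_orderCoeff_eq_zero (hp : 1 ≤ p)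
    (H : ∀ j k, 2 ≤ k → k + j < p → orderCoeff A j k = 0) :
    HasLeadingError A p fun j => orderCoeff A (j : ℕ) (p - (j : ℕ)) := by
  intro d U F t₀ t₁ q hq
  by_cases ht : t₀ < t₁
  · refine (isBigO_stepFilter_iff (f := fun z : ℝ × ℝ => localError A F q z.1 z.2 -
      z.1 ^ (p + 1) • ∑ j : Fin (p - 1), orderCoeff A (j : ℕ) (p - (j : ℕ)) •
        (fderiv ℝ F (q z.2) ^ (j : ℕ)) (remainderDeriv F t₀ t₁ q (p - (j : ℕ)) z.2))).1
      ((hq.isBigO_localError_sub A (by omega) ht).congr' ?_ EventuallyEq.rfl)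
    filter_upwards [eventually_mem_stepFilter P t₀ t₁] with z hz
    congr 1
    have h0 := remainderDeriv_zero (F := F) (t₀ := t₀) (t₁ := t₁) (q := q) z.2
    have h1 := hq.remainderDeriv_one (by omega) ht hz.2.2.1
    set f : ℕ → ℕ → State d := fun k j => (orderCoeff A j k * z.1 ^ (k + j + 1)) •
      (fderiv ℝ F (q z.2) ^ j) (remainderDeriv F t₀ t₁ q k z.2) with hf
    have hf0 : ∀ k j, k + j < p → f k j = 0 := by
      intro k j hkj
      rcases k with _ | _ | k
      · simp only [hf]; rw [h0, map_zero, smul_zero]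
      · simp only [hf]; rw [h1, map_zero, smul_zero]
      · simp only [hf]; rw [H j (k + 2) (by omega) hkj, zero_mul, zero_smul]
    -- only the terms with `k + j = p` remain, and those with `k ≤ 1` vanish
    rw [← Finset.sum_range_diag_flip (p + 1) f, Finset.sum_range_succ, Finset.sum_eq_zero, zero_add]
    · rw [← Finset.sum_flip fun k => f k (p - k)]
      obtain ⟨p, rfl⟩ : ∃ p', p = p' + 1 := ⟨p - 1, by omega⟩
      have e1 : f (p + 1 - p) (p + 1 - (p + 1 - p)) = 0 := by
        rw [show p + 1 - p = 1 by omega]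
        simp only [hf]; rw [h1, map_zero, smul_zero]
      have e2 : f (p + 1 - (p + 1)) (p + 1 - (p + 1 - (p + 1))) = 0 := by
        rw [show p + 1 - (p + 1) = 0 by omega]
        simp only [hf]; rw [h0, map_zero, smul_zero]
      rw [Finset.sum_range_succ, Finset.sum_range_succ, e1, e2, add_zero, add_zero,
        Finset.sum_range, Finset.smul_sum]
      refine Finset.sum_congr rfl fun j _ => ?_
      have hj : p + 1 - (p + 1 - (j : ℕ)) = j := by have := j.2; omega
      have hj' : p + 1 - (j : ℕ) + j + 1 = p + 1 + 1 := by have := j.2; omega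
      simp only [hf]
      rw [hj, hj', smul_smul, mul_comm]
    · intro n hn
      refine Finset.sum_eq_zero fun k hk => hf0 k (n - k) ?_
      rw [Finset.mem_range] at hn hk
      omega
  · exact exists_bound_of_not_lt ht (fun h t => ‖localError A F q h t -
      h ^ (p + 1) • ∑ j : Fin (p - 1), orderCoeff A (j : ℕ) (p - (j : ℕ)) •
        (fderiv ℝ F (q t) ^ (j : ℕ)) (remainderDeriv F t₀ t₁ q (p - (j : ℕ)) t)‖) (p + 2)

end Sufficiency

/-! ### A family of test systems in the plane -/

section Test

/-- The first basis vector of the plane, the direction of time. -/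
def timeVec : State 2 := EuclideanSpace.single 0 1

/-- The second basis vector of the plane. -/
def spaceVec : State 2 := EuclideanSpace.single 1 1

/-- The vector field of the system `τ' = 1`, `z' = lam z + τ ^ k / k!`. -/
def testField (lam : ℝ) (k : ℕ) (y : State 2) : State 2 :=
  timeVec + (lam * y 1 + y 0 ^ k / (k.factorial : ℝ)) • spaceVec

/-- The solution of the test system with `τ = t` and second component `z`. -/
def testSol (z : ℝ → ℝ) (t : ℝ) : State 2 := t • timeVec + z t • spaceVec

/-- The `i`-th derivative of `s ^ k / k!`. -/
def monomialDeriv (k i : ℕ) (s : ℝ) : ℝ :=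
  if i ≤ k then s ^ (k - i) / ((k - i).factorial : ℝ) else 0

/-- The Jacobian of the test system. -/
def testJacobian (lam : ℝ) (k : ℕ) (y : State 2) : State 2 →L[ℝ] State 2 :=
  (lam • (EuclideanSpace.proj 1 : State 2 →L[ℝ] ℝ) +
    monomialDeriv k 1 (y 0) • (EuclideanSpace.proj 0 : State 2 →L[ℝ] ℝ)).smulRight spaceVec

theorem testSol_zero (z : ℝ → ℝ) (t : ℝ) : testSol z t 0 = t := by
  simp [testSol, timeVec, spaceVec]

theorem testSol_one (z : ℝ → ℝ) (t : ℝ) : testSol z t 1 = z t := by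
  simp [testSol, timeVec, spaceVec]

theorem norm_spaceVec : ‖spaceVec‖ = 1 := by simp [spaceVec]

theorem hasDerivAt_monomialDeriv (k i : ℕ) (s : ℝ) :
    HasDerivAt (monomialDeriv k i) (monomialDeriv k (i + 1) s) s := by
  rcases lt_trichotomy i k with h | h | h
  · have e1 : monomialDeriv k i = fun s => s ^ (k - i) / ((k - i).factorial : ℝ) := by
      ext s; simp [monomialDeriv, h.le]
    have e2 : monomialDeriv k (i + 1) s = s ^ (k - (i + 1)) / ((k - (i + 1)).factorial : ℝ) := by
      simp [monomialDeriv, Nat.succ_le_of_lt h]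
    rw [e1, e2]
    obtain ⟨n, hn⟩ : ∃ n, k - i = n + 1 := ⟨k - i - 1, by omega⟩
    have hn' : k - (i + 1) = n := by omega
    rw [hn, hn']
    refine ((hasDerivAt_pow (n + 1) s).div_const _).congr_deriv ?_
    have : (n.factorial : ℝ) ≠ 0 := by positivity
    rw [Nat.factorial_succ]
    simp only [Nat.add_sub_cancel]
    push_cast
    field_simp
  · subst h
    have e1 : monomialDeriv i i = fun _ => 1 := by
      ext s; simp [monomialDeriv]
    rw [e1]
    simpa [monomialDeriv] using hasDerivAt_const s (1 : ℝ)
  · have e1 : monomialDeriv k i = fun _ => 0 := by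
      ext s; simp [monomialDeriv, not_le.2 h]
    rw [e1]
    simpa [monomialDeriv, not_le.2 (h.trans (Nat.lt_succ_self i))] using hasDerivAt_const s (0 : ℝ)

variable {lam : ℝ} {k : ℕ}

theorem testField_eq (lam : ℝ) (k : ℕ) (y : State 2) :
    testField lam k y = timeVec + (lam * y 1 + monomialDeriv k 0 (y 0)) • spaceVec := by
  simp [testField, monomialDeriv]

theorem hasFDerivAt_testField (lam : ℝ) (k : ℕ) (y : State 2) :
    HasFDerivAt (testField lam k) (testJacobian lam k y) y := by
  have h0 : HasFDerivAt (fun y : State 2 => y 0) (EuclideanSpace.proj 0 : State 2 →L[ℝ] ℝ) y :=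
    (EuclideanSpace.proj 0 : State 2 →L[ℝ] ℝ).hasFDerivAt
  have h1 : HasFDerivAt (fun y : State 2 => y 1) (EuclideanSpace.proj 1 : State 2 →L[ℝ] ℝ) y :=
    (EuclideanSpace.proj 1 : State 2 →L[ℝ] ℝ).hasFDerivAt
  have h2 := (hasDerivAt_monomialDeriv k 0 (y 0)).comp_hasFDerivAt y h0
  have h3 := (((h1.const_mul lam).add h2).smul_const spaceVec).const_add timeVec
  refine h3.congr_of_eventuallyEq (Eventually.of_forall fun y => ?_)
  rw [testField_eq]
  rfl

theorem fderiv_testField (lam : ℝ) (k : ℕ) (y : State 2) :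
    fderiv ℝ (testField lam k) y = testJacobian lam k y :=
  (hasFDerivAt_testField lam k y).fderiv

theorem testJacobian_spaceVec (y : State 2) :
    testJacobian lam k y spaceVec = lam • spaceVec := by
  simp [testJacobian, spaceVec]

theorem testJacobian_pow_spaceVec (y : State 2) (j : ℕ) :
    (testJacobian lam k y ^ j) spaceVec = lam ^ j • spaceVec := by
  induction j with
  | zero => simp
  | succ j ih =>
    rw [pow_succ', mul_apply_eq_comp, ih, map_smul, testJacobian_spaceVec, smul_smul, pow_succ]

theorem isSolution_testSol (N : ℕ) {z : ℝ → ℝ}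
    (hz : ∀ t, HasDerivAt z (lam * z t + t ^ k / (k.factorial : ℝ)) t) (a b : ℝ) :
    IsSolution N univ (testField lam k) a b (testSol z) where
  isOpen := isOpen_univ
  smooth := by
    have : ContDiff ℝ N (testField lam k) := by
      unfold testField
      fun_prop
    exact this.contDiffOn
  mem := fun _ _ => mem_univ _
  ode := fun t _ => by
    have h := ((hasDerivAt_id t).smul_const timeVec).add ((hz t).smul_const spaceVec)
    rw [one_smul] at h
    rw [testField, testSol_zero, testSol_one]
    exact h.hasDerivWithinAt

theorem remainder_testSol (z : ℝ → ℝ) (t s : ℝ) :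
    remainder (testField lam k) (testSol z t) (testSol z s) =
      (monomialDeriv k 0 s - (monomialDeriv k 0 t + monomialDeriv k 1 t * (s - t))) •
        spaceVec := by
  rw [remainder, fderiv_testField, testField_eq, testField_eq, testJacobian]
  have h : ∀ (i : Fin 2) (y : State 2), (EuclideanSpace.proj i : State 2 →L[ℝ] ℝ) y = y i :=
    fun _ _ => rfl
  simp only [ContinuousLinearMap.smulRight_apply, _root_.add_apply, _root_.smul_apply,
    h, PiLp.sub_apply, testSol_zero, testSol_one, smul_eq_mul]
  module

/-- The vectors `r_i`, `i ≥ 2`, of the test system do not see the linear part of the field. -/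
theorem remainderDeriv_testSol (z : ℝ → ℝ) {a b : ℝ} (hab : a < b) {t : ℝ} (ht : t ∈ Icc a b)
    {i : ℕ} (hi : 2 ≤ i) :
    remainderDeriv (testField lam k) a b (testSol z) i t = monomialDeriv k i t • spaceVec := by
  obtain ⟨i, rfl⟩ : ∃ i', i = i' + 2 := ⟨i - 2, by omega⟩
  let g : ℕ → ℝ → State 2 := fun j s => match j with
    | 0 => (monomialDeriv k 0 s - (monomialDeriv k 0 t + monomialDeriv k 1 t * (s - t))) •
        spaceVec
    | 1 => (monomialDeriv k 1 s - monomialDeriv k 1 t) • spaceVec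
    | j + 2 => monomialDeriv k (j + 2) s • spaceVec
  have hg : ∀ j < i + 2, ∀ s ∈ Icc a b, HasDerivWithinAt (g j) (g (j + 1) s) (Icc a b) s := by
    intro j _ s _
    have h := hasDerivAt_monomialDeriv k j s
    rcases j with _ | _ | j
    · have h2 := (((hasDerivAt_id s).sub_const t).const_mul (monomialDeriv k 1 t)).const_add
        (monomialDeriv k 0 t)
      rw [mul_one] at h2
      exact ((h.sub h2).smul_const spaceVec).hasDerivWithinAt
    · exact ((h.sub_const _).smul_const spaceVec).hasDerivWithinAt
    · exact (h.smul_const spaceVec).hasDerivWithinAt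
  have h := iteratedDerivWithin_eq_of_tower (uniqueDiffOn_Icc hab) (i + 2) g hg ht
  have h2 : (fun s => remainder (testField lam k) (testSol z t) (testSol z s)) = g 0 := by
    ext1 s; exact remainder_testSol z t s
  rw [remainderDeriv, h2, h]

theorem monomialDeriv_zero_right (k i : ℕ) :
    monomialDeriv k i 0 = if i = k then 1 else 0 := by
  rcases lt_trichotomy i k with h | h | h
  · have : k - i ≠ 0 := by omega
    simp [monomialDeriv, h.le, h.ne, this]
  · simp [monomialDeriv, h]
  · simp [monomialDeriv, not_le.2 h, h.ne']

/-- The second component of the solution of `τ' = 1`, `z' = z + τ ^ k / k!` with `τ = t` and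
`z 0 = 0`. -/
def expTail (k : ℕ) (t : ℝ) : ℝ :=
  Real.exp t - ∑ i ∈ Finset.range (k + 1), t ^ i / (i.factorial : ℝ)

theorem hasDerivAt_expTail (k : ℕ) (t : ℝ) :
    HasDerivAt (expTail k) (1 * expTail k t + t ^ k / (k.factorial : ℝ)) t := by
  have h : ∀ i ∈ Finset.range k, HasDerivAt (fun t : ℝ => t ^ (i + 1) / ((i + 1).factorial : ℝ))
      (t ^ i / (i.factorial : ℝ)) t := by
    intro i _
    refine ((hasDerivAt_pow (i + 1) t).div_const _).congr_deriv ?_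
    have : (i.factorial : ℝ) ≠ 0 := by positivity
    rw [Nat.factorial_succ]
    simp only [Nat.add_sub_cancel]
    push_cast
    field_simp
  have h2 := (Real.hasDerivAt_exp t).sub ((HasDerivAt.fun_sum h).add_const 1)
  have e : expTail k = fun t => Real.exp t -
      (∑ i ∈ Finset.range k, t ^ (i + 1) / ((i + 1).factorial : ℝ) + 1) := by
    ext t; simp [expTail, Finset.sum_range_succ']
  have e2 : 1 * expTail k t + t ^ k / (k.factorial : ℝ) = Real.exp t -
      ∑ i ∈ Finset.range k, t ^ i / (i.factorial : ℝ) := by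
    rw [expTail, Finset.sum_range_succ]; ring
  rw [e2, e]
  exact h2

end Test

/-! ### Order conditions are necessary -/

section Necessity

variable {M P : ℕ} {A : Matrix (Fin M) (Fin P) ℝ} {p : ℕ}

theorem remainderDeriv_testSol_zero {k : ℕ} (hk : 2 ≤ k) (i : ℕ) :
    remainderDeriv (testField 1 k) (-1) 1 (testSol (expTail k)) i 0
      = if i = k then spaceVec else 0 := by
  have h0 : (0 : ℝ) ∈ Icc (-1 : ℝ) 1 := by constructor <;> norm_num
  rcases i with _ | _ | i
  · rw [remainderDeriv_zero, if_neg (by omega)]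
  · rw [if_neg (by omega)]
    exact (isSolution_testSol 1 (hasDerivAt_expTail k) (-1) 1).remainderDeriv_one le_rfl
      (by norm_num) h0
  · rw [remainderDeriv_testSol _ (by norm_num) h0 (by omega), monomialDeriv_zero_right]
    split_ifs <;> simp

/-- On the test system with `lam = 1`, the local error at time `0` shows the order coefficients
with a fixed `k` as the coefficients of a polynomial in the step size. -/
theorem exists_localError_testSol_sub_le (A : Matrix (Fin M) (Fin P) ℝ) {N k : ℕ} (hk : 2 ≤ k)
    (hkN : k < N) :
    ∃ C h₀ : ℝ, 0 < h₀ ∧ ∀ h : ℝ, 0 < h → h ≤ h₀ →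
      ‖localError A (testField 1 k) (testSol (expTail k)) h 0 -
        (h ^ (k + 1) * ∑ j ∈ Finset.range (N - k), orderCoeff A j k * h ^ j) • spaceVec‖
        ≤ C * h ^ (N + 1) := by
  obtain ⟨C, h₀, h0, H⟩ := isBigO_stepFilter_iff.1
    ((isSolution_testSol N (hasDerivAt_expTail k) (-1) 1).isBigO_localError_sub A
      (by omega) (by norm_num))
  -- with `h ≤ 1 / (P + 1)` the step from time `0` stays inside `[-1, 1]`
  refine ⟨C, min h₀ (1 / (P + 1)), by positivity, fun h hh hh0 => ?_⟩
  have h1 : h ≤ 1 / (P + 1) := hh0.trans (min_le_right _ _)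
  rw [le_div_iff₀ (by positivity)] at h1
  have hP : (0 : ℝ) ≤ P * h := by positivity
  have h2 := H h 0 hh (hh0.trans (min_le_left _ _)) (by linarith) (by linarith)
  refine le_trans (le_of_eq ?_) h2
  congr 2
  dsimp only
  rw [Finset.sum_eq_single_of_mem k (Finset.mem_range.2 hkN)]
  · rw [Finset.mul_sum, Finset.sum_smul]
    refine Finset.sum_congr rfl fun j _ => ?_
    rw [remainderDeriv_testSol_zero hk, if_pos rfl, fderiv_testField, testJacobian_pow_spaceVec,
      one_pow, one_smul]
    congr 1
    ring
  · intro i _ hi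
    refine Finset.sum_eq_zero fun j _ => ?_
    rw [remainderDeriv_testSol_zero hk, if_neg hi, map_zero, smul_zero]

theorem coeff_eq_zero_of_norm_smul_spaceVec_le {n m : ℕ} {a : ℕ → ℝ} {C h₀ : ℝ} (h0 : 0 < h₀)
    (H : ∀ h : ℝ, 0 < h → h ≤ h₀ →
      ‖(h ^ m * ∑ j ∈ Finset.range n, a j * h ^ j) • spaceVec‖ ≤ C * h ^ (m + n)) :
    ∀ j < n, a j = 0 := by
  refine coeff_eq_zero_of_abs_sum_le (C := C) h0 fun h hh hh0 => ?_
  have h1 := H h hh hh0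
  have h2 : 0 < h ^ m := by positivity
  rw [norm_smul, norm_spaceVec, mul_one, Real.norm_eq_abs, abs_mul, abs_of_pos h2,
    show C * h ^ (m + n) = h ^ m * (C * h ^ n) by ring] at h1
  exact le_of_mul_le_mul_left h1 h2

theorem HasLocalOrder.orderCoeff_eq_zero (hA : HasLocalOrder A p) {j k : ℕ} (hk : 2 ≤ k)
    (hjk : k + j < p) : orderCoeff A j k = 0 := by
  obtain ⟨C, h₀, h0, H⟩ := exists_localError_testSol_sub_le A hk (by omega : k < p)
  obtain ⟨C', h₀', h0', H'⟩ := hA 2 univ (testField 1 k) (-1) 1 (testSol (expTail k))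
    (isSolution_testSol p (hasDerivAt_expTail k) (-1) 1)
  refine coeff_eq_zero_of_norm_smul_spaceVec_le (n := p - k) (m := k + 1)
    (a := fun j => orderCoeff A j k) (C := C + C')
    (h₀ := min (min h₀ h₀') (1 / (P + 1))) (by positivity) (fun h hh hh0 => ?_) j (by omega)
  have h1 : h ≤ 1 / (P + 1) := hh0.trans (min_le_right _ _)
  rw [le_div_iff₀ (by positivity)] at h1
  have hP : (0 : ℝ) ≤ P * h := by positivity
  have hh1 := hh0.trans (min_le_left _ _)
  have h2 := H' h 0 hh (hh1.trans (min_le_right _ _)) (by linarith) (by linarith)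
  have h3 := H h hh (hh1.trans (min_le_left _ _))
  rw [show k + 1 + (p - k) = p + 1 by omega, add_mul]
  rw [norm_sub_rev] at h3
  exact (norm_le_norm_sub_add _ _).trans (add_le_add h3 h2)

/-- The coefficients of the leading error term are determined by the method. -/
theorem HasLeadingError.eq_orderCoeff {e : Fin (p - 1) → ℝ} (hA : HasLeadingError A p e)
    (j : Fin (p - 1)) : e j = orderCoeff A (j : ℕ) (p - (j : ℕ)) := by
  have hj := j.2
  set k := p - (j : ℕ) with hk
  obtain ⟨C, h₀, h0, H⟩ := exists_localError_testSol_sub_le A (by omega : 2 ≤ k)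
    (by omega : k < p + 1)
  obtain ⟨C', h₀', h0', H'⟩ := hA 2 univ (testField 1 k) (-1) 1 (testSol (expTail k))
    (isSolution_testSol (p + 1) (hasDerivAt_expTail k) (-1) 1)
  have key := coeff_eq_zero_of_norm_smul_spaceVec_le (n := p + 1 - k) (m := k + 1)
    (a := fun i => orderCoeff A i k - if i = (j : ℕ) then e j else 0) (C := C + C')
    (h₀ := min (min h₀ h₀') (1 / (P + 1))) (by positivity) (fun h hh hh0 => ?_) (j : ℕ) (by omega)
  · rw [if_pos rfl] at key
    linarith
  have h1 : h ≤ 1 / (P + 1) := hh0.trans (min_le_right _ _)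
  rw [le_div_iff₀ (by positivity)] at h1
  have hP : (0 : ℝ) ≤ P * h := by positivity
  have hh1 := hh0.trans (min_le_left _ _)
  have h2 := H' h 0 hh (hh1.trans (min_le_right _ _)) (by linarith) (by linarith)
  have h3 := H h hh (hh1.trans (min_le_left _ _))
  rw [Finset.sum_eq_single j] at h2
  · rw [remainderDeriv_testSol_zero (by omega), if_pos rfl, fderiv_testField,
      testJacobian_pow_spaceVec, one_pow, one_smul] at h2
    rw [show k + 1 + (p + 1 - k) = p + 2 by omega, add_mul]
    rw [norm_sub_rev] at h3
    have h4 : ∑ i ∈ Finset.range (p + 1 - k),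
        (orderCoeff A i k - if i = (j : ℕ) then e j else 0) * h ^ i
        = ∑ i ∈ Finset.range (p + 1 - k), orderCoeff A i k * h ^ i - e j * h ^ (j : ℕ) := by
      simp only [sub_mul, Finset.sum_sub_distrib, ite_mul, zero_mul]
      rw [Finset.sum_ite_eq' , if_pos (Finset.mem_range.2 (by omega))]
    have h5 : h ^ (k + 1) * (e j * h ^ (j : ℕ)) = h ^ (p + 1) * e j := by
      rw [show p + 1 = k + 1 + j by omega, pow_add]; ring
    rw [h4, mul_sub, h5, sub_smul]
    rw [smul_smul] at h2
    exact (norm_sub_le_norm_sub_add_norm_sub _ _ _).trans (add_le_add h3 h2)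
  · intro i _ hi
    have : (i : ℕ) ≠ j := fun h => hi (Fin.ext h)
    have := i.2
    rw [remainderDeriv_testSol_zero (by omega), if_neg (by omega), map_zero, smul_zero]
  · exact fun h => absurd (Finset.mem_univ j) h

end Necessity

/-! ### The order of convergence is not larger -/

section NotGlobal

theorem phi_eq_add {d : ℕ} (m : ℕ) (L : State d →L[ℝ] State d) :
    phi m L = ((m.factorial : ℝ)⁻¹) • (1 : State d →L[ℝ] State d) + L * phi (m + 1) L := by
  rw [phi, (phi_summable m L).tsum_eq_zero_add, pow_zero, zero_add, phi,
    ← (phi_summable (m + 1) L).tsum_mul_left]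
  congr 2
  ext1 n
  ext1 v
  rw [mul_apply_eq_comp, _root_.smul_apply, _root_.smul_apply, map_smul, pow_succ',
    mul_apply_eq_comp, show n + 1 + m = n + (m + 1) by ring]

theorem testJacobian_apply_zero (lam : ℝ) (k : ℕ) (y w : State 2) :
    testJacobian lam k y w 0 = 0 := by
  simp [testJacobian, spaceVec]

theorem phi_testJacobian_apply_zero (lam h : ℝ) (k m : ℕ) (y w : State 2) :
    phi m (h • testJacobian lam k y) w 0 = (m.factorial : ℝ)⁻¹ * w 0 := by
  rw [phi_eq_add, _root_.add_apply, PiLp.add_apply, mul_apply_eq_comp, _root_.smul_apply,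
    _root_.smul_apply, PiLp.smul_apply, PiLp.smul_apply, testJacobian_apply_zero, smul_zero,
    add_zero]
  rfl

variable {M P : ℕ} {A : Matrix (Fin M) (Fin P) ℝ} {p : ℕ}

/-- The method is exact in the time component of the test systems. -/
theorem localError_testSol_apply_zero (A : Matrix (Fin M) (Fin P) ℝ) (lam : ℝ) (k : ℕ)
    (z : ℝ → ℝ) (h t : ℝ) : localError A (testField lam k) (testSol z) h t 0 = 0 := by
  have hs : spaceVec 0 = 0 := by simp [spaceVec]
  have ht : timeVec 0 = 1 := by simp [timeVec]
  have hsum : ∀ {ι : Type} (s : Finset ι) (f : ι → State 2), (∑ i ∈ s, f i) 0 = ∑ i ∈ s, f i 0 :=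
    fun s f => map_sum (EuclideanSpace.proj 0 : State 2 →L[ℝ] ℝ) f s
  rw [localError, step, fderiv_testField]
  simp only [PiLp.sub_apply, PiLp.add_apply, hsum, phi_testJacobian_apply_zero, PiLp.smul_apply,
    remainder_testSol, hs, testSol_zero, testField, ht, smul_eq_mul, mul_zero,
    Finset.sum_const_zero, add_zero]
  simp

theorem eq_smul_spaceVec {v : State 2} (hv : v 0 = 0) : v = v 1 • spaceVec := by
  ext i
  fin_cases i <;> simp [spaceVec, hv]

/-- If the field depends on the time only, then a step commutes with translations in the direction
of the second component. -/
theorem step_testField_add (A : Matrix (Fin M) (Fin P) ℝ) (k : ℕ) (h : ℝ) (x : State 2)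
    (prev : Fin P → State 2) (c : ℝ) (c' : Fin P → ℝ) :
    step A (testField 0 k) h (x + c • spaceVec) (fun i => prev i + c' i • spaceVec)
      = step A (testField 0 k) h x prev + c • spaceVec := by
  have hF : ∀ (y : State 2) (c : ℝ), testField 0 k (y + c • spaceVec) = testField 0 k y := by
    intro y c
    simp [testField, spaceVec]
  have hJ : testJacobian 0 k (x + c • spaceVec) = testJacobian 0 k x := by
    simp [testJacobian, spaceVec]
  have hR : ∀ (y : State 2) (c' : ℝ),
      remainder (testField 0 k) (x + c • spaceVec) (y + c' • spaceVec)
        = remainder (testField 0 k) x y := by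
    intro y c'
    have e : y + c' • spaceVec - (x + c • spaceVec) = y - x + (c' - c) • spaceVec := by module
    rw [remainder, remainder, hF, hF, fderiv_testField, fderiv_testField, hJ, e, map_add,
      map_smul, testJacobian_spaceVec, zero_smul, smul_zero, add_zero]
  simp only [step, fderiv_testField, hJ, hF, hR]
  abel

theorem hasDerivAt_quadrature (p : ℕ) (t : ℝ) :
    HasDerivAt (monomialDeriv (p + 1) 0) (0 * monomialDeriv (p + 1) 0 t +
      t ^ p / (p.factorial : ℝ)) t := by
  refine (hasDerivAt_monomialDeriv (p + 1) 0 t).congr_deriv ?_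
  simp [monomialDeriv]

/-- On the test system with `lam = 0`, the local errors of a method of order `p` are
asymptotically constant, and add up to a global error that is not `O(h ^ (p + 1))`. -/
theorem HasLeadingError.not_hasGlobalOrder {e : Fin (p - 1) → ℝ} (hA : HasLeadingError A p e)
    (hp : 2 ≤ p) (he : e ⟨0, by omega⟩ ≠ 0) : ¬ HasGlobalOrder A (p + 1) := by
  intro hG
  set q : ℝ → State 2 := testSol (monomialDeriv (p + 1) 0) with hq
  have hsol : ∀ N, IsSolution N univ (testField 0 p) 0 1 q := fun N =>
    isSolution_testSol N (hasDerivAt_quadrature p) 0 1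
  obtain ⟨C, h₀, h0, H⟩ := hA 2 univ (testField 0 p) 0 1 q (hsol (p + 1))
  obtain ⟨C', h₀', h0', H'⟩ := hG 2 univ (testField 0 p) 0 1 q (hsol (p + 1)) 0
  set E : ℝ → ℝ → State 2 := localError A (testField 0 p) q with hE
  have hE1 : ∀ h t, E h t = E h t 1 • spaceVec := fun h t =>
    eq_smul_spaceVec (localError_testSol_apply_zero A 0 p _ h t)
  -- the leading term is the same at all times
  have hlead : ∀ h t : ℝ, 0 < h → h ≤ h₀ → 0 ≤ t - P * h → t + h ≤ 1 →
      ‖E h t - (h ^ (p + 1) * e ⟨0, by omega⟩) • spaceVec‖ ≤ C * h ^ (p + 2) := by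
    intro h t hh hh0 ht ht1
    have hP : (0 : ℝ) ≤ P * h := by positivity
    have h1 := H h t hh hh0 ht ht1
    rw [Finset.sum_eq_single ⟨0, by omega⟩] at h1
    · rw [remainderDeriv_testSol _ one_pos ⟨by linarith, by linarith⟩ (by dsimp only; omega)] at h1
      simpa [monomialDeriv, smul_smul] using h1
    · intro j _ hj
      have hj0 : (j : ℕ) ≠ 0 := fun h => hj (Fin.ext h)
      have := j.2
      rw [remainderDeriv_testSol _ one_pos ⟨by linarith, by linarith⟩ (by omega),
        fderiv_testField, map_smul, testJacobian_pow_spaceVec, zero_pow hj0, zero_smul, smul_zero,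
        smul_zero]
    · exact fun h => absurd (Finset.mem_univ _) h
  -- the numerical solution for `N` steps, which is exact for the starting values
  have key : ∀ N : ℕ, P ≤ N → 0 < N → (1 : ℝ) / N ≤ h₀ → (1 : ℝ) / N ≤ h₀' →
      ((N : ℝ) - P) * |e ⟨0, by omega⟩| ≤ |C| + C' := by
    intro N hPN hN hN1 hN2
    set h : ℝ := 1 / N with hh
    have hNpos : (0 : ℝ) < N := by exact_mod_cast hN
    have hpos : 0 < h := by positivity
    have hNh : N * h = 1 := by rw [hh]; field_simp
    let Q : ℕ → State 2 := fun n => q (n * h) + ∑ m ∈ Finset.Ico P n, E h (m * h)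
    have hQ : ∀ n, Q n = q (n * h) + (∑ m ∈ Finset.Ico P n, E h (m * h) 1) • spaceVec := by
      intro n
      rw [Finset.sum_smul]
      exact congrArg (q (n * h) + ·) (Finset.sum_congr rfl fun m _ => hE1 _ _)
    have hQerr : ∀ n, Q n - q (0 + n * h) = ∑ m ∈ Finset.Ico P n, E h (m * h) := by
      intro n
      rw [zero_add]
      exact add_sub_cancel_left _ _
    have h1 := H' h Q hpos hN2 (fun n hn _ => by
        rw [hQerr, Finset.Ico_eq_empty (by omega), Finset.sum_empty, norm_zero, zero_mul])
      (fun n hn _ => by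
        have e1 : (fun i : Fin P => Q (n - ((i : ℕ) + 1))) = fun i : Fin P =>
            q (n * h - ((i : ℕ) + 1 : ℝ) * h) +
              (∑ m ∈ Finset.Ico P (n - ((i : ℕ) + 1)), E h (m * h) 1) • spaceVec := by
          ext1 i
          have : (i : ℕ) + 1 ≤ n := by have := i.2; omega
          rw [hQ, Nat.cast_sub this]
          push_cast
          rw [sub_mul]
        rw [e1, hQ n, step_testField_add, hQ (n + 1), Finset.sum_Ico_succ_top hn, add_smul,
          ← hE1]
        simp only [hE, localError]
        push_cast
        rw [add_mul, one_mul]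
        abel) N (by rw [zero_add, hNh])
    rw [hQerr] at h1
    have h2 : ‖∑ m ∈ Finset.Ico P N,
        (E h (m * h) - (h ^ (p + 1) * e ⟨0, by omega⟩) • spaceVec)‖ ≤ |C| * h ^ (p + 1) := by
      have h3 : ∀ m ∈ Finset.Ico P N,
          ‖E h (m * h) - (h ^ (p + 1) * e ⟨0, by omega⟩) • spaceVec‖ ≤ |C| * h ^ (p + 2) := by
        intro m hm
        rw [Finset.mem_Ico] at hm
        refine (hlead h (m * h) hpos hN1 ?_ ?_).trans
          (mul_le_mul_of_nonneg_right (le_abs_self C) (by positivity))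
        · rw [← sub_mul]
          exact mul_nonneg (sub_nonneg.2 (by exact_mod_cast hm.1)) hpos.le
        · have : (m : ℝ) + 1 ≤ N := by exact_mod_cast hm.2
          nlinarith
      refine (norm_sum_le_of_le _ h3).trans ?_
      rw [Finset.sum_const, Nat.card_Ico, nsmul_eq_mul]
      have h4 : ((N - P : ℕ) : ℝ) ≤ N := by exact_mod_cast Nat.sub_le N P
      calc ((N - P : ℕ) : ℝ) * (|C| * h ^ (p + 2)) ≤ N * (|C| * h ^ (p + 2)) := by gcongr
        _ = |C| * h ^ (p + 1) * (N * h) := by ring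
        _ = _ := by rw [hNh, mul_one]
    rw [Finset.sum_sub_distrib, Finset.sum_const, Nat.card_Ico] at h2
    have h5 : ‖(N - P) • ((h ^ (p + 1) * e ⟨0, by omega⟩) • spaceVec)‖
        = ((N : ℝ) - P) * |e ⟨0, by omega⟩| * h ^ (p + 1) := by
      rw [← Nat.cast_smul_eq_nsmul ℝ, norm_smul, norm_smul, norm_spaceVec, Nat.cast_sub hPN,
        Real.norm_eq_abs, Real.norm_eq_abs, abs_mul, abs_of_pos (pow_pos hpos _),
        abs_of_nonneg (sub_nonneg.2 (by exact_mod_cast hPN))]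
      ring
    have h6 := norm_le_norm_sub_add ((N - P) • ((h ^ (p + 1) * e ⟨0, by omega⟩) • spaceVec))
      (∑ m ∈ Finset.Ico P N, E h (m * h))
    rw [norm_sub_rev, h5] at h6
    have h7 : ((N : ℝ) - P) * |e ⟨0, by omega⟩| * h ^ (p + 1) ≤ (|C| + C') * h ^ (p + 1) := by
      linarith
    exact le_of_mul_le_mul_right h7 (by positivity)
  obtain ⟨N, hN⟩ := exists_nat_gt (max (max (1 / h₀) (1 / h₀'))
    ((|C| + C') / |e ⟨0, by omega⟩|))
  have hN1 := ((le_max_left _ _).trans (le_max_left _ _)).trans_lt hN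
  have hN2 := ((le_max_right _ _).trans (le_max_left _ _)).trans_lt hN
  have hN3 := (le_max_right _ _).trans_lt hN
  have hNpos : (0 : ℝ) < N := lt_trans (by positivity) hN1
  have hPpos : (0 : ℝ) ≤ P := Nat.cast_nonneg P
  have he' : 0 < |e ⟨0, by omega⟩| := abs_pos.2 he
  have hk := key (N + P) (by omega)
    (Nat.add_pos_left (by exact_mod_cast hNpos) P)
    (by
      push_cast
      rw [one_div_le (by linarith) h0]
      linarith)
    (by
      push_cast
      rw [one_div_le (by linarith) h0']
      linarith)
  rw [div_lt_iff₀ he'] at hN3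
  push_cast at hk
  rw [add_sub_cancel_right] at hk
  linarith

end NotGlobal

/-! ### Stability and convergence -/

section Convergence

variable {d : ℕ} {M P p : ℕ} {A : Matrix (Fin M) (Fin P) ℝ} {U : Set (State d)}
  {F : State d → State d} {t₀ t₁ : ℝ} {q : ℝ → State d}

/-- In a tube around the solution, the points, the field, its derivative and the Lipschitz constants
of the latter two on balls about the points of the solution have a common bound. -/
theorem IsSolution.exists_tube (hq : IsSolution p U F t₀ t₁ q) (hp : 2 ≤ p) :
    ∃ δ B : ℝ, 0 < δ ∧ 0 ≤ B ∧ ∀ t ∈ Icc t₀ t₁, ∀ x ∈ Metric.closedBall (q t) δ,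
      ‖x‖ ≤ B ∧ ‖F x‖ ≤ B ∧ ‖fderiv ℝ F x‖ ≤ B ∧
      ‖F x - F (q t)‖ ≤ B * ‖x - q t‖ ∧
      ‖fderiv ℝ F x - fderiv ℝ F (q t)‖ ≤ B * ‖x - q t‖ := by
  have hc : ContinuousOn q (Icc t₀ t₁) := fun t ht => (hq.ode t ht).continuousWithinAt
  have hK : IsCompact (q '' Icc t₀ t₁) := isCompact_Icc.image_of_continuousOn hc
  obtain ⟨δ, hδ, hT⟩ := hK.exists_cthickening_subset_open hq.isOpen (image_subset_iff.2 hq.mem)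
  have hTc : IsCompact (Metric.cthickening δ (q '' Icc t₀ t₁)) := hK.cthickening
  have hF1 : ContDiffOn ℝ 1 (fderiv ℝ F) U :=
    hq.smooth.fderiv_of_isOpen hq.isOpen (by exact_mod_cast hp)
  have hF2 : ContinuousOn (fderiv ℝ (fderiv ℝ F)) U :=
    hF1.continuousOn_fderiv_of_isOpen hq.isOpen le_rfl
  obtain ⟨B₀, hB₀⟩ := hTc.exists_bound_of_continuousOn continuousOn_id
  obtain ⟨B₁, hB₁⟩ := hTc.exists_bound_of_continuousOn (hq.smooth.continuousOn.mono hT)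
  obtain ⟨B₂, hB₂⟩ := hTc.exists_bound_of_continuousOn (hF1.continuousOn.mono hT)
  obtain ⟨B₃, hB₃⟩ := hTc.exists_bound_of_continuousOn
    (f := fderiv ℝ (fderiv ℝ F)) (E := State d →L[ℝ] State d →L[ℝ] State d) (hF2.mono hT)
  refine ⟨δ, max (max (max B₀ B₁) (max B₂ B₃)) 0, hδ, le_max_right _ _, fun t ht x hx => ?_⟩
  set B := max (max (max B₀ B₁) (max B₂ B₃)) 0 with hB
  have h0 : B₀ ≤ B := by simp [hB]
  have h1 : B₁ ≤ B := by simp [hB]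
  have h2 : B₂ ≤ B := by simp [hB]
  have h3 : B₃ ≤ B := by simp [hB]
  have hsub : Metric.closedBall (q t) δ ⊆ Metric.cthickening δ (q '' Icc t₀ t₁) :=
    Metric.closedBall_subset_cthickening (mem_image_of_mem q ht) δ
  have hcen : q t ∈ Metric.closedBall (q t) δ := Metric.mem_closedBall_self hδ.le
  refine ⟨(hB₀ x (hsub hx)).trans h0, (hB₁ x (hsub hx)).trans h1, (hB₂ x (hsub hx)).trans h2,
    ?_, ?_⟩
  · exact (convex_closedBall (q t) δ).norm_image_sub_le_of_norm_hasFDerivWithin_le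
      (fun y hy => (hq.hasFDerivAt (by omega) (hT (hsub hy))).hasFDerivWithinAt)
      (fun y hy => (hB₂ y (hsub hy)).trans h2) hcen hx
  · exact (convex_closedBall (q t) δ).norm_image_sub_le_of_norm_hasFDerivWithin_le
      (fun y hy => (((hF1.contDiffAt (hq.isOpen.mem_nhds (hT (hsub hy)))).differentiableAt
        one_ne_zero).hasFDerivAt).hasFDerivWithinAt)
      (fun y hy => (hB₃ y (hsub hy)).trans h3) hcen hx

theorem norm_phi_apply_sub_le (m : ℕ) {B η h : ℝ} (hB : 0 ≤ B) (h0 : 0 < h) (h1 : h ≤ 1)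
    {K L : State d →L[ℝ] State d} (hK : ‖K‖ ≤ B) (hL : ‖L‖ ≤ B) (hKL : ‖K - L‖ ≤ B * η)
    {u v : State d} {a b : ℝ} (hu : ‖u - v‖ ≤ h * a) (hv : ‖v‖ ≤ h * b) (hη : 0 ≤ η) :
    ‖phi m (h • K) u - phi m (h • L) v‖ ≤ h * (Real.exp B * a + Real.exp B * (B * η) * b) := by
  have hs : ∀ {X : State d →L[ℝ] State d} {c : ℝ}, ‖X‖ ≤ c → ‖h • X‖ ≤ c := by
    intro X c hX
    rw [norm_smul, Real.norm_eq_abs, abs_of_pos h0]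
    exact (mul_le_of_le_one_left (norm_nonneg _) h1).trans hX
  have e : phi m (h • K) u - phi m (h • L) v
      = phi m (h • K) (u - v) + (phi m (h • K) - phi m (h • L)) v := by
    rw [map_sub, _root_.sub_apply]; abel
  have e1 : ‖phi m (h • K)‖ ≤ Real.exp B :=
    (norm_phi_le m _).trans (Real.exp_le_exp.2 (hs hK))
  have e2 : ‖phi m (h • K) - phi m (h • L)‖ ≤ Real.exp B * (B * η) := by
    refine (norm_phi_sub_phi_le m (hs hK) (hs hL)).trans ?_
    rw [show h • K - h • L = h • (K - L) from (smul_sub _ _ _).symm]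
    gcongr
    exact hs hKL
  rw [e]
  calc _ ≤ ‖phi m (h • K)‖ * ‖u - v‖ + ‖phi m (h • K) - phi m (h • L)‖ * ‖v‖ :=
        (norm_add_le _ _).trans (add_le_add (ContinuousLinearMap.le_opNorm _ _)
          (ContinuousLinearMap.le_opNorm _ _))
    _ ≤ Real.exp B * (h * a) + Real.exp B * (B * η) * (h * b) := by gcongr
    _ = _ := by ring

/-- The increment of the method is Lipschitz near the solution, uniformly in time, with a constant
proportional to the step size. -/
theorem IsSolution.exists_step_lipschitz (A : Matrix (Fin M) (Fin P) ℝ)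
    (hq : IsSolution p U F t₀ t₁ q) (hp : 2 ≤ p) :
    ∃ δ L : ℝ, 0 < δ ∧ 0 ≤ L ∧ ∀ (h η t : ℝ) (s : Fin P → ℝ) (x : State d) (y : Fin P → State d),
      0 < h → h ≤ 1 → η ≤ δ → t ∈ Icc t₀ t₁ → (∀ i, s i ∈ Icc t₀ t₁) → ‖x - q t‖ ≤ η →
      (∀ i, ‖y i - q (s i)‖ ≤ η) →
      ‖step A F h x y - x - (step A F h (q t) (fun i => q (s i)) - q t)‖ ≤ h * L * η := by
  obtain ⟨δ, B, hδ, hB, H⟩ := hq.exists_tube hp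
  let S : Fin M → ℝ := fun m => ∑ i, |A m i|
  have hS : ∀ m, 0 ≤ S m := fun m => Finset.sum_nonneg fun i _ => abs_nonneg _
  refine ⟨δ, Real.exp B * B + Real.exp B * B * B + ∑ m : Fin M, (Real.exp B *
    (S m * (4 * B + 2 * B * B)) + Real.exp B * B * (S m * (2 * B + 2 * B * B))), hδ, ?_, ?_⟩
  · have : 0 ≤ ∑ m : Fin M, (Real.exp B *
      (S m * (4 * B + 2 * B * B)) + Real.exp B * B * (S m * (2 * B + 2 * B * B))) :=
      Finset.sum_nonneg fun m _ => by have := hS m; positivity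
    positivity
  intro h η t s x y h0 h1 hη ht hs hx hy
  have hη0 : 0 ≤ η := (norm_nonneg _).trans hx
  obtain ⟨bx, bFx, bJx, lFx, lJx⟩ := H t ht x (mem_closedBall_iff_norm.2 (hx.trans hη))
  obtain ⟨bq, bFq, bJq, -, -⟩ := H t ht (q t) (Metric.mem_closedBall_self hδ.le)
  have lFx' : ‖F x - F (q t)‖ ≤ B * η := lFx.trans (by gcongr)
  have lJx' : ‖fderiv ℝ F x - fderiv ℝ F (q t)‖ ≤ B * η := lJx.trans (by gcongr)
  have hR : ∀ i, ‖remainder F x (y i) - remainder F (q t) (q (s i))‖ ≤ (4 * B + 2 * B * B) * η := by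
    intro i
    obtain ⟨-, -, -, lFy, -⟩ := H (s i) (hs i) (y i)
      (mem_closedBall_iff_norm.2 ((hy i).trans hη))
    obtain ⟨bs, -, -, -, -⟩ := H (s i) (hs i) (q (s i)) (Metric.mem_closedBall_self hδ.le)
    have lFy' : ‖F (y i) - F (q (s i))‖ ≤ B * η := lFy.trans (by gcongr; exact hy i)
    have e : remainder F x (y i) - remainder F (q t) (q (s i)) =
        (F (y i) - F (q (s i))) - (F x - F (q t)) -
        fderiv ℝ F x ((y i - q (s i)) - (x - q t)) -
        (fderiv ℝ F x - fderiv ℝ F (q t)) (q (s i) - q t) := by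
      simp only [remainder, map_sub, _root_.sub_apply]; abel
    have n1 : ‖fderiv ℝ F x ((y i - q (s i)) - (x - q t))‖ ≤ B * (η + η) :=
      (ContinuousLinearMap.le_opNorm _ _).trans
        (mul_le_mul bJx ((norm_sub_le _ _).trans (add_le_add (hy i) hx)) (norm_nonneg _) hB)
    have n2 : ‖(fderiv ℝ F x - fderiv ℝ F (q t)) (q (s i) - q t)‖ ≤ B * η * (B + B) :=
      (ContinuousLinearMap.le_opNorm _ _).trans
        (mul_le_mul lJx' ((norm_sub_le _ _).trans (add_le_add bs bq)) (norm_nonneg _)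
          (by positivity))
    rw [e]
    have n3 := norm_sub_le ((F (y i) - F (q (s i))) - (F x - F (q t)) -
        fderiv ℝ F x ((y i - q (s i)) - (x - q t)))
        ((fderiv ℝ F x - fderiv ℝ F (q t)) (q (s i) - q t))
    have n4 := norm_sub_le ((F (y i) - F (q (s i))) - (F x - F (q t)))
        (fderiv ℝ F x ((y i - q (s i)) - (x - q t)))
    have n5 := norm_sub_le (F (y i) - F (q (s i))) (F x - F (q t))
    linarith
  have hR0 : ∀ i, ‖remainder F (q t) (q (s i))‖ ≤ 2 * B + 2 * B * B := by
    intro i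
    obtain ⟨bs, bFs, -, -, -⟩ := H (s i) (hs i) (q (s i)) (Metric.mem_closedBall_self hδ.le)
    have n1 : ‖fderiv ℝ F (q t) (q (s i) - q t)‖ ≤ B * (B + B) :=
      (ContinuousLinearMap.le_opNorm _ _).trans
        (mul_le_mul bJq ((norm_sub_le _ _).trans (add_le_add bs bq)) (norm_nonneg _) hB)
    have n2 := norm_sub_le (F (q (s i)) - F (q t)) (fderiv ℝ F (q t) (q (s i) - q t))
    have n3 := norm_sub_le (F (q (s i))) (F (q t))
    rw [remainder]
    linarith
  have hsum : ∀ (m : Fin M) (v : Fin P → State d) (c : ℝ), (∀ i, ‖v i‖ ≤ c) →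
      ‖∑ i, A m i • h • v i‖ ≤ h * (S m * c) := by
    intro m v c hv
    have : h * (S m * c) = ∑ i, |A m i| * (h * c) := by
      simp only [S, Finset.sum_mul, Finset.mul_sum]
      exact Finset.sum_congr rfl fun i _ => by ring
    rw [this]
    refine norm_sum_le_of_le _ fun i _ => ?_
    rw [norm_smul, norm_smul, Real.norm_eq_abs, Real.norm_eq_abs, abs_of_pos h0]
    have := hv i
    gcongr
  have hm : ∀ m : Fin M, ‖phi ((m : ℕ) + 1) (h • fderiv ℝ F x)
        (∑ i : Fin P, A m i • h • remainder F x (y i)) -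
      phi ((m : ℕ) + 1) (h • fderiv ℝ F (q t))
        (∑ i : Fin P, A m i • h • remainder F (q t) (q (s i)))‖
      ≤ h * (Real.exp B * (S m * ((4 * B + 2 * B * B) * η)) +
        Real.exp B * (B * η) * (S m * (2 * B + 2 * B * B))) := by
    intro m
    refine norm_phi_apply_sub_le _ hB h0 h1 bJx bJq lJx' ?_ (hsum m _ _ hR0) hη0
    simp only [← Finset.sum_sub_distrib, ← smul_sub]
    exact hsum m _ _ hR
  have h1' : ‖phi 1 (h • fderiv ℝ F x) (h • F x) - phi 1 (h • fderiv ℝ F (q t)) (h • F (q t))‖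
      ≤ h * (Real.exp B * (B * η) + Real.exp B * (B * η) * B) := by
    refine norm_phi_apply_sub_le 1 hB h0 h1 bJx bJq lJx' ?_ ?_ hη0
    · rw [← smul_sub, norm_smul, Real.norm_eq_abs, abs_of_pos h0]
      gcongr
    · rw [norm_smul, Real.norm_eq_abs, abs_of_pos h0]
      gcongr
  have e : step A F h x y - x - (step A F h (q t) (fun i => q (s i)) - q t)
      = (phi 1 (h • fderiv ℝ F x) (h • F x) - phi 1 (h • fderiv ℝ F (q t)) (h • F (q t)))
        + ∑ m : Fin M, (phi ((m : ℕ) + 1) (h • fderiv ℝ F x)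
          (∑ i : Fin P, A m i • h • remainder F x (y i)) -
          phi ((m : ℕ) + 1) (h • fderiv ℝ F (q t))
          (∑ i : Fin P, A m i • h • remainder F (q t) (q (s i)))) := by
    rw [Finset.sum_sub_distrib, step, step]
    abel
  rw [e]
  refine (norm_add_le_of_le h1' (norm_sum_le_of_le _ fun m _ => hm m)).trans (le_of_eq ?_)
  simp only [mul_add, add_mul, Finset.mul_sum, Finset.sum_mul, Finset.sum_add_distrib]
  ring_nf

/-- Consistency implies convergence of the same order. The induction carries along that the
numerical solution stays in the tube where the increment is Lipschitz. -/
theorem HasLocalOrder.hasGlobalOrder (hA : HasLocalOrder A p) (hp : 2 ≤ p) :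
    HasGlobalOrder A p := by
  intro d U F t₀ t₁ q hq C₀
  obtain ⟨δ, L, hδ, hL, hstep⟩ := hq.exists_step_lipschitz A hp
  obtain ⟨C, h₁, hh₁, hC⟩ := hA d U F t₀ t₁ q hq
  set T : ℝ := |t₁ - t₀| with hT
  set K : ℝ := Real.exp (L * T) * (|C₀| + T * |C|) with hK
  have hT0 : 0 ≤ T := abs_nonneg _
  have hK0 : 0 ≤ K := by positivity
  -- `h ≤ δ / (K + 1)` ensures that the error bound `K h ^ p` is at most `δ`
  refine ⟨K, min (min h₁ 1) (δ / (K + 1)), by positivity, ?_⟩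
  intro h Q h0 hh hstart hQ
  have hh1 : h ≤ h₁ := hh.trans ((min_le_left _ _).trans (min_le_left _ _))
  have hh2 : h ≤ 1 := hh.trans ((min_le_left _ _).trans (min_le_right _ _))
  have hh3 : h * (K + 1) ≤ δ := (le_div_iff₀ (by positivity)).1 (hh.trans (min_le_right _ _))
  let b : ℕ → ℝ := fun n => (1 + h * L) ^ n * (|C₀| * h ^ p + n * (|C| * h ^ (p + 1)))
  have hbase : 1 ≤ 1 + h * L := by have := mul_nonneg h0.le hL; linarith
  have hb0 : ∀ n, 0 ≤ b n := fun n => by positivity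
  have hbmono : Monotone b := by
    intro m n hmn
    have : (m : ℝ) ≤ n := by exact_mod_cast hmn
    have h2 := pow_le_pow_right₀ hbase hmn
    simp only [b]
    gcongr
  have hbK : ∀ n : ℕ, t₀ + n * h ≤ t₁ → b n ≤ K * h ^ p := by
    intro n hn
    have hnh : n * h ≤ T := by
      have := le_abs_self (t₁ - t₀)
      linarith
    have h1 : (1 + h * L) ^ n ≤ Real.exp (L * T) := by
      calc (1 + h * L) ^ n ≤ Real.exp (h * L) ^ n := by
            gcongr
            rw [add_comm]; exact Real.add_one_le_exp _
        _ = Real.exp (L * (n * h)) := by rw [← Real.exp_nat_mul]; ring_nf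
        _ ≤ _ := by gcongr
    calc b n ≤ Real.exp (L * T) * (|C₀| * h ^ p + n * (|C| * h ^ (p + 1))) := by
          simp only [b]; gcongr
      _ = Real.exp (L * T) * (|C₀| + n * h * |C|) * h ^ p := by ring
      _ ≤ Real.exp (L * T) * (|C₀| + T * |C|) * h ^ p := by gcongr
      _ = _ := by rw [hK]
  have hbδ : ∀ n : ℕ, t₀ + n * h ≤ t₁ → b n ≤ δ := by
    intro n hn
    refine (hbK n hn).trans (le_trans ?_ hh3)
    have h1 : h ^ p ≤ h := pow_le_of_le_one h0.le hh2 (by omega)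
    calc K * h ^ p ≤ K * h := by gcongr
      _ ≤ h * (K + 1) := by linarith
  have main : ∀ n : ℕ, t₀ + n * h ≤ t₁ → ‖Q n - q (t₀ + n * h)‖ ≤ b n := by
    intro n
    induction n using Nat.strong_induction_on with
    | _ n ih =>
      intro hn
      rcases Nat.lt_or_ge P n with hPn | hPn
      · obtain ⟨n, rfl⟩ : ∃ n', n = n' + 1 := ⟨n - 1, by omega⟩
        have hPn' : P ≤ n := by omega
        push_cast at hn
        have hn' : t₀ + n * h ≤ t₁ := by linarith
        have herr : ∀ m ≤ n, ‖Q m - q (t₀ + m * h)‖ ≤ b n := by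
          intro m hm
          have : (m : ℝ) * h ≤ n * h := by gcongr
          exact (ih m (by omega) (by linarith)).trans (hbmono hm)
        have hmem : ∀ m ≤ n, t₀ + m * h ∈ Icc t₀ t₁ := by
          intro m hm
          have h2 : (m : ℝ) * h ≤ n * h := by gcongr
          have h3 : 0 ≤ (m : ℝ) * h := by positivity
          exact ⟨by linarith, by linarith⟩
        have hcast : ∀ i : Fin P, t₀ + ((n - ((i : ℕ) + 1) : ℕ) : ℝ) * h
            = t₀ + n * h - ((i : ℕ) + 1 : ℝ) * h := by
          intro i
          have : (i : ℕ) + 1 ≤ n := by have := i.2; omega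
          rw [Nat.cast_sub this]
          push_cast
          ring
        have h1 := hstep h (b n) (t₀ + n * h) (fun i => t₀ + n * h - ((i : ℕ) + 1 : ℝ) * h) (Q n)
          (fun i => Q (n - ((i : ℕ) + 1))) h0 hh2 (hbδ n hn') (hmem n le_rfl)
          (fun i => by rw [← hcast]; exact hmem _ (Nat.sub_le _ _)) (herr n le_rfl)
          (fun i => by rw [← hcast]; exact herr _ (Nat.sub_le _ _))
        have hP : (P : ℝ) * h ≤ n * h := by gcongr
        have h2 := hC h (t₀ + n * h) h0 hh1 (by linarith) (by linarith)
        have h3 : C * h ^ (p + 1) ≤ |C| * h ^ (p + 1) :=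
          mul_le_mul_of_nonneg_right (le_abs_self C) (by positivity)
        have e : Q (n + 1) - q (t₀ + (n + 1 : ℕ) * h) =
            (Q n - q (t₀ + n * h)) +
            (step A F h (Q n) (fun i => Q (n - ((i : ℕ) + 1))) - Q n -
              (step A F h (q (t₀ + n * h))
                (fun i => q (t₀ + n * h - ((i : ℕ) + 1 : ℝ) * h)) - q (t₀ + n * h))) +
            localError A F q h (t₀ + n * h) := by
          rw [hQ n hPn' (by linarith), localError]
          have : t₀ + ((n + 1 : ℕ) : ℝ) * h = t₀ + n * h + h := by push_cast; ring
          rw [this]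
          abel
        rw [e]
        refine (norm_add_le_of_le (norm_add_le_of_le (herr n le_rfl) h1) (h2.trans h3)).trans ?_
        have h4 : |C| * h ^ (p + 1) ≤ (1 + h * L) ^ (n + 1) * (|C| * h ^ (p + 1)) :=
          le_mul_of_one_le_left (by positivity) (one_le_pow₀ hbase)
        have h5 : b (n + 1) = (1 + h * L) * b n +
            (1 + h * L) ^ (n + 1) * (|C| * h ^ (p + 1)) := by
          simp only [b]; push_cast; ring
        rw [h5]
        linarith
      · refine (hstart n hPn hn).trans ?_
        calc C₀ * h ^ p ≤ |C₀| * h ^ p := by gcongr; exact le_abs_self _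
          _ ≤ b 0 := by simp [b]
          _ ≤ b n := hbmono (Nat.zero_le n)
  exact fun n hn => (main n hn).trans (hbK n hn)

end Convergence

/-! ### Methods with `P` previous values and order `P + 2` -/

section Optimal

variable {M P : ℕ} {A A' : Matrix (Fin M) (Fin P) ℝ}

theorem orderCoeff_zero_left (A : Matrix (Fin M) (Fin P) ℝ) (k : ℕ) :
    orderCoeff A 0 k = (∑ i : Fin P, (∑ m : Fin M, A m i * (((m : ℕ) + 1).factorial : ℝ)⁻¹) *
      (-((i : ℕ) + 1 : ℝ)) ^ k) / (k.factorial : ℝ) - ((k + 1).factorial : ℝ)⁻¹ := by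
  rw [orderCoeff, Finset.sum_comm, Finset.sum_div, add_zero]
  congr 1
  refine Finset.sum_congr rfl fun i _ => ?_
  rw [Finset.sum_mul, Finset.sum_div]
  refine Finset.sum_congr rfl fun m _ => ?_
  rw [zero_add]
  ring

/-- The conditions with `j = 0` are those of a quadrature formula with the nodes `-1, …, -P`, a
double node at `0` being implicit. Such a formula is unique (Vandermonde), and hence so is its error
constant. -/
theorem orderCoeff_zero_left_unique (hA : ∀ k, 2 ≤ k → k < P + 2 → orderCoeff A 0 k = 0)
    (hA' : ∀ k, 2 ≤ k → k < P + 2 → orderCoeff A' 0 k = 0) (k : ℕ) :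
    orderCoeff A 0 k = orderCoeff A' 0 k := by
  let w : Matrix (Fin M) (Fin P) ℝ → Fin P → ℝ := fun B i =>
    ∑ m : Fin M, B m i * (((m : ℕ) + 1).factorial : ℝ)⁻¹
  have hw : w A = w A' := by
    have h : (fun i : Fin P => (w A i - w A' i) * (-((i : ℕ) + 1 : ℝ)) ^ 2) = 0 := by
      refine Matrix.eq_zero_of_forall_pow_sum_mul_pow_eq_zero
        (f := fun i : Fin P => -((i : ℕ) + 1 : ℝ)) (fun i i' hi => ?_) fun l => ?_
      · have hi' : ((i : ℕ) : ℝ) = ((i' : ℕ) : ℝ) := by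
          simp only at hi
          linarith
        exact Fin.ext (by exact_mod_cast hi')
      · have h1 := hA (l + 2) (by omega) (by omega)
        have h2 := hA' (l + 2) (by omega) (by omega)
        rw [orderCoeff_zero_left] at h1 h2
        have h0 : ((((l : ℕ) + 2).factorial : ℕ) : ℝ) ≠ 0 := by positivity
        have h3 := sub_left_injective (h1.trans h2.symm)
        rw [div_left_inj' h0] at h3
        simp only [sub_mul, Finset.sum_sub_distrib]
        rw [sub_eq_zero]
        simpa only [mul_assoc, ← pow_add, add_comm 2] using h3
    ext i
    have h1 := congrFun h i
    simp only [Pi.zero_apply, mul_eq_zero] at h1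
    rcases h1 with h1 | h1
    · exact sub_eq_zero.1 h1
    · have : (0 : ℝ) < (i : ℕ) + 1 := by positivity
      exact absurd h1 (pow_ne_zero 2 (neg_ne_zero.2 this.ne'))
  rw [orderCoeff_zero_left, orderCoeff_zero_left]
  change (∑ i : Fin P, w A i * _) / _ - _ = (∑ i : Fin P, w A' i * _) / _ - _
  rw [hw]

/-- If all coefficients of the leading error term but the first vanish, then the order is exact and
the leading error term is minimal, since the first coefficient is the same for all methods of the
same size and order. -/
theorem exact_order_of_orderCoeff
    (H : ∀ j k, 2 ≤ k → k + j < P + 2 → orderCoeff A j k = 0)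
    (H' : ∀ j < P, orderCoeff A (j + 1) (P + 1 - j) = 0) (h0 : orderCoeff A 0 (P + 2) ≠ 0) :
    HasLocalOrder A (P + 2) ∧ HasGlobalOrder A (P + 2) ∧ ¬ HasLocalOrder A (P + 2 + 1) ∧
      ¬ HasGlobalOrder A (P + 2 + 1) ∧ MinimizesLeadingError A (P + 2) := by
  have hl := hasLocalOrder_of_orderCoeff_eq_zero (by omega) H
  have he := hasLeadingError_of_orderCoeff_eq_zero (by omega) H
  refine ⟨hl, hl.hasGlobalOrder (by omega), fun h => h0 ?_, ?_, _, he, fun A' e' hA' he' j => ?_⟩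
  · exact h.orderCoeff_eq_zero (by omega) (by omega)
  · exact he.not_hasGlobalOrder (by omega) h0
  · rw [he'.eq_orderCoeff]
    obtain ⟨j, hj⟩ := j
    rcases j with _ | j
    · refine le_of_eq (congrArg _ (orderCoeff_zero_left_unique (fun k h1 h2 => H 0 k h1 h2)
        (fun k h1 h2 => hA'.orderCoeff_eq_zero h1 h2) _))
    · have h1 := H' j (by omega)
      rw [show P + 1 - j = P + 2 - (j + 1) by omega] at h1
      dsimp only
      rw [h1, abs_zero]
      exact abs_nonneg _

end Optimal

/-! ### The coefficients of EPI4, EPI5 and EPI6 -/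

theorem orderCoeff_A₄ (j k : ℕ) : orderCoeff A₄ j k =
    (-3 / 10 * (-1) ^ k + 3 / 40 * (-2) ^ k) /
      (k.factorial * (j + 2).factorial) +
    (32 / 5 * (-1) ^ k - 11 / 10 * (-2) ^ k) /
      (k.factorial * (j + 3).factorial) -
    1 / ((k + j + 1).factorial : ℝ) := by
  simp [orderCoeff, A₄, Fin.sum_univ_succ]
  ring

theorem exact_order_A₄ : HasLocalOrder A₄ 4 ∧ HasGlobalOrder A₄ 4 ∧ ¬ HasLocalOrder A₄ 5 ∧
    ¬ HasGlobalOrder A₄ 5 ∧ MinimizesLeadingError A₄ 4 := by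
  refine exact_order_of_orderCoeff (fun j k hk hjk => ?_) (fun j hj => ?_) ?_
  · have : j < 2 := by omega
    have : k < 4 := by omega
    rw [orderCoeff_A₄]
    interval_cases j <;> interval_cases k <;> first
      | omega
      | norm_num [Nat.factorial]
  · rw [orderCoeff_A₄]
    interval_cases j <;> norm_num [Nat.factorial]
  · rw [orderCoeff_A₄]
    norm_num [Nat.factorial]

theorem orderCoeff_A₅ (j k : ℕ) : orderCoeff A₅ j k =
    (-4 / 5 * (-1) ^ k + 2 / 5 * (-2) ^ k - 4 / 45 * (-3) ^ k) /
      (k.factorial * (j + 2).factorial) +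
    (12 * (-1) ^ k - 9 / 2 * (-2) ^ k + 8 / 9 * (-3) ^ k) /
      (k.factorial * (j + 3).factorial) +
    (3 * (-1) ^ k - 1 / 3 * (-3) ^ k) /
      (k.factorial * (j + 4).factorial) -
    1 / ((k + j + 1).factorial : ℝ) := by
  simp [orderCoeff, A₅, Fin.sum_univ_succ]
  ring

theorem exact_order_A₅ : HasLocalOrder A₅ 5 ∧ HasGlobalOrder A₅ 5 ∧ ¬ HasLocalOrder A₅ 6 ∧
    ¬ HasGlobalOrder A₅ 6 ∧ MinimizesLeadingError A₅ 5 := by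
  refine exact_order_of_orderCoeff (fun j k hk hjk => ?_) (fun j hj => ?_) ?_
  · have : j < 3 := by omega
    have : k < 5 := by omega
    rw [orderCoeff_A₅]
    interval_cases j <;> interval_cases k <;> first
      | omega
      | norm_num [Nat.factorial]
  · rw [orderCoeff_A₅]
    interval_cases j <;> norm_num [Nat.factorial]
  · rw [orderCoeff_A₅]
    norm_num [Nat.factorial]

theorem orderCoeff_A₆ (j k : ℕ) : orderCoeff A₆ j k =
    (-49 / 60 * (-1) ^ k + 351 / 560 * (-2) ^ k - 359 / 1260 * (-3) ^ k + 367 / 6720 * (-4) ^ k) /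
      (k.factorial * (j + 2).factorial) +
    (92 / 7 * (-1) ^ k - 99 / 14 * (-2) ^ k + 176 / 63 * (-3) ^ k - 1 / 2 * (-4) ^ k) /
      (k.factorial * (j + 3).factorial) +
    (485 / 21 * (-1) ^ k - 151 / 14 * (-2) ^ k + 23 / 9 * (-3) ^ k - 31 / 168 * (-4) ^ k) /
      (k.factorial * (j + 4).factorial) -
    1 / ((k + j + 1).factorial : ℝ) := by
  simp [orderCoeff, A₆, Fin.sum_univ_succ]
  ring

theorem exact_order_A₆ : HasLocalOrder A₆ 6 ∧ HasGlobalOrder A₆ 6 ∧ ¬ HasLocalOrder A₆ 7 ∧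
    ¬ HasGlobalOrder A₆ 7 ∧ MinimizesLeadingError A₆ 6 := by
  refine exact_order_of_orderCoeff (fun j k hk hjk => ?_) (fun j hj => ?_) ?_
  · have : j < 4 := by omega
    have : k < 6 := by omega
    rw [orderCoeff_A₆]
    interval_cases j <;> interval_cases k <;> first
      | omega
      | norm_num [Nat.factorial]
  · rw [orderCoeff_A₆]
    interval_cases j <;> norm_num [Nat.factorial]
  · rw [orderCoeff_A₆]
    norm_num [Nat.factorial]

end EPI

end

/-- The schemes EPI4, EPI5 and EPI6 have order exactly 4, 5 and 6, for the local error and for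
convergence, and the coefficients of their leading error terms have the smallest magnitude. -/
theorem mainTheorem1 :
    (EPI.HasLocalOrder EPI.A₄ 4 ∧ EPI.HasGlobalOrder EPI.A₄ 4 ∧
      ¬ EPI.HasLocalOrder EPI.A₄ 5 ∧ ¬ EPI.HasGlobalOrder EPI.A₄ 5 ∧
      EPI.MinimizesLeadingError EPI.A₄ 4) ∧
    (EPI.HasLocalOrder EPI.A₅ 5 ∧ EPI.HasGlobalOrder EPI.A₅ 5 ∧
      ¬ EPI.HasLocalOrder EPI.A₅ 6 ∧ ¬ EPI.HasGlobalOrder EPI.A₅ 6 ∧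
      EPI.MinimizesLeadingError EPI.A₅ 5) ∧
    (EPI.HasLocalOrder EPI.A₆ 6 ∧ EPI.HasGlobalOrder EPI.A₆ 6 ∧
      ¬ EPI.HasLocalOrder EPI.A₆ 7 ∧ ¬ EPI.HasGlobalOrder EPI.A₆ 7 ∧
      EPI.MinimizesLeadingError EPI.A₆ 6) :=
  ⟨EPI.exact_order_A₄, EPI.exact_order_A₅, EPI.exact_order_A₆⟩
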